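/- Let $\Omega=(0,1)$, $T>0$, $y_0,y_d\in L^2(\Omega)$, and let $\omega\subset\Omega$ be open and nonempty with characteristic function $\chi_\omega$. Let $a\in L^\infty(\mathbb R)$ be $1$-periodic with $0<a_0\le a(x)\le a_1$ for a.e. $x\in\mathbb R$, and put $a_\varepsilon(x)=a(x/\varepsilon)$ for $\varepsilon>0$ and $a_h=\left(\int_0^1 \frac{1}{a(x)}\,dx\right)^{-1}$. For a coefficient $c\in\{a_\varepsilon,a_h\}$ consider the evolutionary problem of minimizing $$J^T(f)=\frac12\int_0^T\left(\|f(\cdot,t)\|_{L^2(\Omega)}^2+\|y(\cdot,t)-y_d\|_{L^2(\Omega)}^2\right)dt$$ over $f\in L^2(0,T;L^2(\Omega))$, where $y\in L^2(0,T;H_0^1(\Omega))$ with $y_t\in L^2(0,T;H^{-1}(\Omega))$ (so $y\in C([0,T];L^2(\Omega))$) is the weak solution of $$y_t-(c\,y_x)_x=\chi_\omega f \text{ in }\Omega\times(0,T),\qquad y(0,t)=y(1,t)=0,\qquad y(\cdot,0)=y_0,$$ and the stationary problem of minimizing $$J^s(\overline f)=\frac12\left(\|\overline f\|_{L^2(\Omega)}^2+\|\overline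 y-y_d\|_{L^2(\Omega)}^2\right)$$ over $\overline f\in L^2(\Omega)$, where $\overline y\in H_0^1(\Omega)$ is the weak solution of $-(c\,\overline y_x)_x=\chi_\omega\overline f$ in $\Omega$, $\overline y(0)=\overline y(1)=0$. Each of these problems has a unique optimal state-control pair. Denote the optimal pairs by $(y^\varepsilon,f^\varepsilon)$ and $(\overline y^\varepsilon,\overline f^\varepsilon)$ for $c=a_\varepsilon$, and by $(y,f)$ and $(\overline y,\overline f)$ for $c=a_h$. Then, as $\varepsilon\to0^+$, $$f^\varepsilon\to f\ \text{ strongly in } L^2(0,T;L^2(\Omega)),\qquad y^\varepsilon\to y\ \text{ strongly in } C([0,T];L^2(\Omega)),$$ $$\overline f^\varepsilon\to\overline f\quad\text{and}\quad \overline y^\varepsilon\to\overline y\quad\text{strongly in } L^2(\Omega).$$ -/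

import Mathlib

open MeasureTheory Set Filter Topology

noncomputable section

namespace HeatHomogenization

/-- The space `L²(Ω)` for `Ω = (0,1)`. -/
abbrev L2 : Type := Lp ℝ 2 (volume.restrict (Ioo (0 : ℝ) 1))

/-- The Bochner space `L²(0,T;X)`. -/
abbrev L2Time (T : ℝ) (X : Type) [NormedAddCommGroup X] : Type :=
  Lp X 2 (volume.restrict (Ioo (0 : ℝ) T))

/-- `φ` is a test function on the interval `(α, β)`, i.e. `φ ∈ C_c^∞((α, β))`. -/
structure IsTest (α β : ℝ) (φ : ℝ → ℝ) : Prop where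
  smooth : ContDiff ℝ ((⊤ : ℕ∞) : WithTop ℕ∞) φ
  compact : HasCompactSupport φ
  supp : tsupport φ ⊆ Ioo α β

/-- The pairs `(φ, φ')` in `L²(0,1) × L²(0,1)` with `φ ∈ C_c^∞((0,1))`. -/
def testGraph : Submodule ℝ (WithLp 2 (L2 × L2)) where
  carrier := {p | ∃ φ : ℝ → ℝ, IsTest 0 1 φ ∧
    p.fst =ᵐ[volume.restrict (Ioo (0 : ℝ) 1)] φ ∧
    p.snd =ᵐ[volume.restrict (Ioo (0 : ℝ) 1)] deriv φ}
  zero_mem' := by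
    refine ⟨0, ⟨contDiff_const, HasCompactSupport.zero, by simp [tsupport]⟩, ?_, ?_⟩
    · exact Lp.coeFn_zero ℝ 2 _
    · have h : deriv (0 : ℝ → ℝ) = 0 := by ext x; simp
      rw [h]
      exact Lp.coeFn_zero ℝ 2 _
  add_mem' := by
    rintro p q ⟨φ, hφ, h1, h2⟩ ⟨ψ, hψ, h3, h4⟩
    refine ⟨φ + ψ, ⟨hφ.smooth.add hψ.smooth, hφ.compact.add hψ.compact,
      (tsupport_add φ ψ).trans (union_subset hφ.supp hψ.supp)⟩, ?_, ?_⟩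
    · exact (Lp.coeFn_add p.fst q.fst).trans (h1.add h3)
    · have h : deriv (φ + ψ) = deriv φ + deriv ψ := by
        ext x
        exact deriv_add (hφ.smooth.differentiable (by simp) x)
          (hψ.smooth.differentiable (by simp) x)
      rw [h]
      exact (Lp.coeFn_add p.snd q.snd).trans (h2.add h4)
  smul_mem' := by
    rintro c p ⟨φ, hφ, h1, h2⟩
    refine ⟨c • φ, ⟨hφ.smooth.const_smul c, hφ.compact.smul_left (f := fun _ => c),
      (closure_mono (Function.support_const_smul_subset c φ)).trans hφ.supp⟩, ?_, ?_⟩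
    · exact (Lp.coeFn_smul c p.fst).trans (h1.const_smul c)
    · have h : deriv (c • φ) = c • deriv φ := by
        ext x
        exact deriv_const_smul c (hφ.smooth.differentiable (by simp) x)
      rw [h]
      exact (Lp.coeFn_smul c p.snd).trans (h2.const_smul c)

/-- The Sobolev space `H¹₀(0,1)`, the closure of `C_c^∞((0,1))` in the `H¹` norm. An element `u`
is stored as the pair `(u.fst, u.snd)` of the function and its weak derivative, with the norm
`‖u‖² = ‖u.fst‖² + ‖u.snd‖²`. -/
def H10 : Submodule ℝ (WithLp 2 (L2 × L2)) := testGraph.topologicalClosure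

/-- The function in `L²(0,1)` underlying an element of `H¹₀(0,1)`. -/
def toL2 (u : H10) : L2 := (u : WithLp 2 (L2 × L2)).fst

/-- The weak derivative of an element of `H¹₀(0,1)`. -/
def weakDx (u : H10) : L2 := (u : WithLp 2 (L2 × L2)).snd

/-- The bilinear form `∫₀¹ c u_x v_x dx` of the operator `u ↦ -(c u_x)_x`. -/
def diffusionForm (c : ℝ → ℝ) (u v : H10) : ℝ :=
  ∫ x in Ioo (0 : ℝ) 1, c x * weakDx u x * weakDx v x

/-- The pairing `∫₀¹ χ_ω f v dx`. -/
def controlPairing (ω : Set ℝ) (f : L2) (v : H10) : ℝ :=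
  ∫ x in Ioo (0 : ℝ) 1, ω.indicator f x * toL2 v x

/-- `g ∈ L²(0,T;H⁻¹)` is the distributional time derivative of `u ∈ L²(0,T;H¹₀)`, where `H⁻¹` is
the dual of `H¹₀` and `L²` is embedded in it through the `L²` inner product. -/
def IsTimeDeriv (T : ℝ) (u : L2Time T H10) (g : L2Time T (StrongDual ℝ H10)) : Prop :=
  ∀ φ : ℝ → ℝ, IsTest 0 T φ → ∀ v : H10,
    ∫ t in Ioo (0 : ℝ) T, deriv φ t * inner ℝ (toL2 (u t)) (toL2 v) =
      -∫ t in Ioo (0 : ℝ) T, φ t * g t v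

/-- `y ∈ C([0,T];L²(0,1))` is (the continuous representative of) the weak solution in
`W(0,T) = {y ∈ L²(0,T;H¹₀), y_t ∈ L²(0,T;H⁻¹)}` of
`y_t - (c y_x)_x = χ_ω f` in `(0,1) × (0,T)`, `y(0,t) = y(1,t) = 0`, `y(·,0) = y₀`. -/
def IsHeatSolution {T : ℝ} (hT : 0 ≤ T) (ω : Set ℝ) (c : ℝ → ℝ) (y₀ : L2)
    (f : L2Time T L2) (y : C(Icc (0 : ℝ) T, L2)) : Prop :=
  y ⟨0, left_mem_Icc.2 hT⟩ = y₀ ∧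
  ∃ (u : L2Time T H10) (g : L2Time T (StrongDual ℝ H10)),
    (∀ᵐ t ∂volume.restrict (Ioo (0 : ℝ) T), toL2 (u t) = IccExtend hT y t) ∧
    IsTimeDeriv T u g ∧
    ∀ v : H10, ∀ᵐ t ∂volume.restrict (Ioo (0 : ℝ) T),
      g t v + diffusionForm c (u t) v = controlPairing ω (f t) v

/-- The cost `½ ∫₀ᵀ (‖f(t)‖² + ‖y(t) - y_d‖²) dt`. -/
def heatCost {T : ℝ} (hT : 0 ≤ T) (yd : L2) (f : L2Time T L2)
    (y : C(Icc (0 : ℝ) T, L2)) : ℝ :=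
  (1 / 2) * ∫ t in Ioo (0 : ℝ) T, (‖f t‖ ^ 2 + ‖IccExtend hT y t - yd‖ ^ 2)

/-- `(y, f)` is an optimal state-control pair of the evolutionary problem with diffusion
coefficient `c`, initial datum `y₀`, target `yd` and control region `ω`. -/
def IsHeatOptimal {T : ℝ} (hT : 0 ≤ T) (ω : Set ℝ) (c : ℝ → ℝ) (y₀ yd : L2)
    (y : C(Icc (0 : ℝ) T, L2)) (f : L2Time T L2) : Prop :=
  IsHeatSolution hT ω c y₀ f y ∧
  ∀ (z : C(Icc (0 : ℝ) T, L2)) (g : L2Time T L2), IsHeatSolution hT ω c y₀ g z →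
    heatCost hT yd f y ≤ heatCost hT yd g z

/-- `y ∈ H¹₀(0,1)` is the weak solution of `-(c y_x)_x = χ_ω f` in `(0,1)`, `y(0) = y(1) = 0`. -/
def IsStatSolution (ω : Set ℝ) (c : ℝ → ℝ) (f : L2) (y : H10) : Prop :=
  ∀ v : H10, diffusionForm c y v = controlPairing ω f v

/-- The cost `½ (‖f‖² + ‖y - y_d‖²)`. -/
def statCost (yd : L2) (f : L2) (y : H10) : ℝ :=
  (1 / 2) * (‖f‖ ^ 2 + ‖toL2 y - yd‖ ^ 2)

/-- `(y, f)` is an optimal state-control pair of the stationary problem. -/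
def IsStatOptimal (ω : Set ℝ) (c : ℝ → ℝ) (yd : L2) (y : H10) (f : L2) : Prop :=
  IsStatSolution ω c f y ∧
  ∀ (z : H10) (g : L2), IsStatSolution ω c g z → statCost yd f y ≤ statCost yd g z

/-- The rapidly oscillating coefficient `a_ε(x) = a(x/ε)`. -/
def oscCoeff (a : ℝ → ℝ) (ε : ℝ) : ℝ → ℝ := fun x => a (x / ε)

/-- The homogenized coefficient `a_h = (∫₀¹ 1/a(x) dx)⁻¹`, as a constant function. -/
def homCoeff (a : ℝ → ℝ) : ℝ → ℝ := fun _ => (∫ x in Ioo (0 : ℝ) 1, 1 / a x)⁻¹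

end HeatHomogenization

end

open HeatHomogenization

/-! In one dimension everything reduces to operator-norm convergence of the inverse elliptic
operators `S = (-(c u_x)_x)⁻¹` on `L²(0,1)`. Two solution operators differ, when tested, by `∫ (1/c₁
- 1/c₂) σ₁ σ₂`, where the fluxes `σ = c u_x` are absolutely continuous because they are primitives
of the data (`IsElliptic.exists_flux`, `IsElliptic.inner_inv_sub_inv`). Integrating by parts, only
the primitive of `1/c₁ - 1/c₂` matters. For `a_ε` against the harmonic mean, that primitive is `ε`
times a bounded periodic function, so the inverses converge at rate `ε`
(`exists_norm_inv_sub_inv_le`).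

The heat equation is handled through `S` as well, without semigroups or unbounded operators. Let `K`
be the primitive in time. With zero initial datum, `y = K y'` and `S y' + y = S F`, so `y' = S (S +
K)⁻¹ F`. The operators `S` and `K` commute and `⟨S x, K x⟩ ≥ 0`, which is the energy estimate. Hence
`S (S + K)⁻¹` and `K (S + K)⁻¹` extend to contractions, and an identity of resolvent type bounds the
change of `K S (S + K)⁻¹` by the change of `S` (`IsAccretivePair.norm_right_comp_fst_sub_le`). The
control-to-state operators therefore converge in norm. The free evolution converges strongly in
`C([0,T];L²)`, by density of the data `S w` (`IsPosInjective.tendsto_flow`).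

Both control problems minimize `‖f‖² + ‖L f + b‖²` for a bounded `L`. The unique minimizer solves
`(1 + L*L) f = -L*b` and depends continuously on `L` in norm and on `b`
(`tendsto_of_eulerLagrange`). Norm convergence is what carries the adjoints along. The states then
follow from the controls. -/

noncomputable section

namespace HeatHomogenization

/-! ### Test functions and weak derivatives on an interval -/

section RealAnalysis

variable {α β : ℝ} {φ : ℝ → ℝ}

lemma IsTest.continuous (h : IsTest α β φ) : Continuous φ := h.smooth.continuous

lemma IsTest.differentiable (h : IsTest α β φ) : Differentiable ℝ φ :=
  h.smooth.differentiable (by simp)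

lemma IsTest.continuous_deriv (h : IsTest α β φ) : Continuous (deriv φ) :=
  h.smooth.continuous_deriv (by exact_mod_cast le_top)

lemma IsTest.eq_zero (h : IsTest α β φ) {x : ℝ} (hx : x ∉ Ioo α β) : φ x = 0 :=
  image_eq_zero_of_notMem_tsupport fun h' => hx (h.supp h')

lemma IsTest.absolutelyContinuousOnInterval (h : IsTest α β φ) (p q : ℝ) :
    AbsolutelyContinuousOnInterval φ p q :=
  ((h.smooth.of_le (by exact_mod_cast le_top)).contDiffOn).absolutelyContinuousOnInterval

lemma intervalIntegrable_of_integrable_Ioo {E : Type*} [NormedAddCommGroup E] {h : ℝ → E}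
    (hαβ : α ≤ β) (hh : Integrable h (volume.restrict (Ioo α β))) :
    IntervalIntegrable h volume α β := by
  rw [intervalIntegrable_iff_integrableOn_Ioo_of_le hαβ]
  exact hh

lemma intervalIntegral_eq_Ioo {E : Type*} [NormedAddCommGroup E] [NormedSpace ℝ E] (h : ℝ → E)
    (hαβ : α ≤ β) : ∫ x in α..β, h x = ∫ x in Ioo α β, h x := by
  rw [intervalIntegral.integral_of_le hαβ, integral_Ioc_eq_integral_Ioo]

/-- The a.e. derivative of an indefinite integral. -/
lemma deriv_intervalIntegral_ae {h : ℝ → ℝ} (hαβ : α ≤ β)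
    (hh : Integrable h (volume.restrict (Ioo α β))) :
    ∀ᵐ x ∂volume.restrict (Ioo α β), deriv (fun t => ∫ s in α..t, h s) x = h x := by
  have h1 := (intervalIntegrable_of_integrable_Ioo hαβ hh).ae_hasDerivAt_integral
  filter_upwards [ae_restrict_of_ae h1, ae_restrict_mem measurableSet_Ioo] with x hx hx'
  exact (hx (uIcc_of_le hαβ ▸ Ioo_subset_Icc_self hx') α left_mem_uIcc).deriv

/-- Integration by parts for absolutely continuous functions; the boundary terms drop out because
`φ` vanishes at both endpoints. -/
lemma integral_deriv_mul_primitive (hαβ : α ≤ β) (hφ : IsTest α β φ) {h : ℝ → ℝ}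
    (hh : Integrable h (volume.restrict (Ioo α β))) :
    ∫ t in Ioo α β, deriv φ t * (∫ s in α..t, h s) = -∫ t in Ioo α β, φ t * h t := by
  have hi := intervalIntegrable_of_integrable_Ioo hαβ hh
  have hAC := hi.absolutelyContinuousOnInterval_intervalIntegral (c := α) left_mem_uIcc
  have := (hφ.absolutelyContinuousOnInterval α β).integral_mul_deriv_eq_deriv_mul hAC
  rw [hφ.eq_zero right_notMem_Ioo, hφ.eq_zero left_notMem_Ioo,
    intervalIntegral_eq_Ioo _ hαβ, intervalIntegral_eq_Ioo _ hαβ,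
    intervalIntegral_eq_Ioo _ hαβ] at this
  rw [← neg_eq_iff_eq_neg, eq_comm]
  have h2 : ∫ t in Ioo α β, φ t * h t =
      ∫ t in Ioo α β, φ t * deriv (fun t => ∫ s in α..t, h s) t := by
    refine integral_congr_ae ?_
    filter_upwards [deriv_intervalIntegral_ae hαβ hh] with x hx
    rw [hx]
  rw [h2, this]
  simp

lemma exists_isTest_integral_eq_one (hαβ : α < β) :
    ∃ ρ : ℝ → ℝ, IsTest α β ρ ∧ ∫ x, ρ x = 1 := by
  let b : ContDiffBump ((α + β) / 2) :=
    ⟨(β - α) / 8, (β - α) / 4, by linarith, by linarith⟩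
  refine ⟨b.normed volume, ⟨b.contDiff_normed, b.hasCompactSupport_normed, ?_⟩, b.integral_normed⟩
  rw [b.tsupport_normed_eq]
  intro x hx
  have h1 : |x - (α + β) / 2| ≤ (β - α) / 4 := by
    simpa [Real.dist_eq] using hx
  rw [abs_le] at h1
  constructor <;> linarith [h1.1, h1.2]

lemma exists_tsupport_subset_Icc (hαβ : α < β) (hφ : IsTest α β φ) :
    ∃ p q, α < p ∧ q < β ∧ tsupport φ ⊆ Icc p q := by
  have hc : IsCompact (tsupport φ) := hφ.compact
  rcases (tsupport φ).eq_empty_or_nonempty with h | h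
  -- With empty support the endpoints may be taken in reverse order, which satisfies both strict
  -- inequalities.
  · exact ⟨β, α, hαβ, hαβ, by simp [h]⟩
  · obtain ⟨p, hp, hp'⟩ := hc.exists_isLeast h
    obtain ⟨q, hq, hq'⟩ := hc.exists_isGreatest h
    exact ⟨p, q, (hφ.supp hp).1, (hφ.supp hq).2, fun x hx => ⟨hp' hx, hq' hx⟩⟩

/-- A test function of mean zero is the derivative of a test function. -/
lemma exists_isTest_deriv_eq (hαβ : α < β) (hφ : IsTest α β φ) (h0 : ∫ x, φ x = 0) :
    ∃ ψ : ℝ → ℝ, IsTest α β ψ ∧ deriv ψ = φ := by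
  obtain ⟨p, q, hp, hq, hpq⟩ := exists_tsupport_subset_Icc hαβ hφ
  let ψ : ℝ → ℝ := fun x => ∫ s in α..x, φ s
  have hd : ∀ x, HasDerivAt ψ (φ x) x := fun x =>
    intervalIntegral.integral_hasDerivAt_right (hφ.continuous.intervalIntegrable _ _)
      (hφ.continuous.stronglyMeasurableAtFilter _ _) hφ.continuous.continuousAt
  have hderiv : deriv ψ = φ := funext fun x => (hd x).deriv
  have hz : ∀ x, x ∉ Icc p q → φ x = 0 := fun x hx =>
    image_eq_zero_of_notMem_tsupport fun h' => hx (hpq h')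
  have hsupp : Function.support ψ ⊆ Icc p q := by
    intro x hx
    by_contra hx'
    apply hx
    rcases lt_or_ge x p with h | h
    · refine (intervalIntegral.integral_congr (g := fun _ => 0) fun s hs => ?_).trans (by simp)
      refine hz s fun h' => ?_
      have : max α x < p := max_lt hp h
      exact absurd (lt_of_le_of_lt hs.2 this) (not_lt.2 h'.1)
    · have hqx : q < x := lt_of_not_ge fun h'' => hx' ⟨h, h''⟩
      -- To the right of `q` the primitive is the total integral, which is zero, less the
      -- contribution from the left of `α`, also zero. The shift by `1` keeps the support off the
      -- excluded left endpoint of `Ioc`.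
      have hs : Function.support φ ⊆ Ioc (min α p - 1) (max x q) := by
        intro s hs
        have : s ∈ Icc p q := hpq (subset_tsupport _ hs)
        exact ⟨by linarith [min_le_right α p, this.1], this.2.trans (le_max_right _ _)⟩
      have h1 : ∫ s in (min α p - 1)..(max x q), φ s = 0 := by
        rw [intervalIntegral.integral_eq_integral_of_support_subset hs, h0]
      rw [max_eq_left hqx.le] at h1
      have h2 : ∫ s in (min α p - 1)..α, φ s = 0 := by
        refine (intervalIntegral.integral_congr (g := fun _ => 0) fun s hs => ?_).trans (by simp)
        refine hz s fun h' => ?_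
        have h3 : max (min α p - 1) α < p :=
          max_lt (by linarith [min_le_right α p]) hp
        exact absurd (lt_of_le_of_lt hs.2 h3) (not_lt.2 h'.1)
      have h3 := intervalIntegral.integral_add_adjacent_intervals
        (hφ.continuous.intervalIntegrable (μ := volume) (min α p - 1) α)
        (hφ.continuous.intervalIntegrable (μ := volume) α x)
      rw [h1, h2, zero_add] at h3
      exact h3
  have hts : tsupport ψ ⊆ Icc p q := closure_minimal hsupp isClosed_Icc
  refine ⟨ψ, ⟨?_, isCompact_Icc.of_isClosed_subset (isClosed_tsupport _) hts, fun x hx => ?_⟩,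
    hderiv⟩
  · rw [contDiff_infty_iff_deriv]
    refine ⟨fun x => (hd x).differentiableAt, ?_⟩
    rw [hderiv]
    exact hφ.smooth
  · exact ⟨hp.trans_le (hts hx).1, (hts hx).2.trans_lt hq⟩

lemma IsTest.integrable_mul (hφ : IsTest α β φ) {F : ℝ → ℝ}
    (hF : Integrable F (volume.restrict (Ioo α β))) :
    Integrable (fun x => F x * φ x) (volume.restrict (Ioo α β)) := by
  obtain ⟨C, hC⟩ := hφ.compact.exists_bound_of_continuous hφ.continuous
  exact hF.mul_bdd (c := C) hφ.continuous.aestronglyMeasurable (Eventually.of_forall hC)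

lemma IsTest.setIntegral_eq (hφ : IsTest α β φ) (F : ℝ → ℝ) :
    ∫ x in Ioo α β, F x * φ x = ∫ x, F x * φ x := by
  refine setIntegral_eq_integral_of_forall_compl_eq_zero fun x hx => ?_
  rw [hφ.eq_zero hx, mul_zero]

lemma ae_eq_zero_of_integral_mul_isTest {F : ℝ → ℝ}
    (hF : Integrable F (volume.restrict (Ioo α β)))
    (h : ∀ φ, IsTest α β φ → ∫ x in Ioo α β, F x * φ x = 0) :
    F =ᵐ[volume.restrict (Ioo α β)] 0 := by
  have := isOpen_Ioo.ae_eq_zero_of_integral_contDiff_smul_eq_zero (μ := volume) (f := F)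
    (U := Ioo α β) (IntegrableOn.locallyIntegrableOn hF) (fun g hg hg' hg'' => by
      have h1 := h g ⟨hg, hg', hg''⟩
      rw [(⟨hg, hg', hg''⟩ : IsTest α β g).setIntegral_eq] at h1
      simpa [mul_comm] using h1)
  exact (ae_restrict_iff' measurableSet_Ioo).2 this

lemma IsTest.sub_smul {ρ : ℝ → ℝ} (hφ : IsTest α β φ) (hρ : IsTest α β ρ) (c : ℝ) :
    IsTest α β (fun x => φ x - c * ρ x) := by
  have h : tsupport (fun x => φ x - c * ρ x) ⊆ tsupport φ ∪ tsupport ρ := by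
    refine closure_minimal (fun x hx => ?_) ((isClosed_tsupport _).union (isClosed_tsupport _))
    by_contra h'
    rw [mem_union, not_or] at h'
    apply hx
    simp [image_eq_zero_of_notMem_tsupport h'.1, image_eq_zero_of_notMem_tsupport h'.2]
  refine ⟨hφ.smooth.sub (contDiff_const.mul hρ.smooth), ?_, h.trans (union_subset hφ.supp hρ.supp)⟩
  exact (hφ.compact.isCompact.union hρ.compact.isCompact).of_isClosed_subset
    (isClosed_tsupport _) h

/-- The lemma of du Bois-Reymond. -/
lemma ae_eq_const_of_integral_mul_deriv_isTest (hαβ : α < β) {F : ℝ → ℝ}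
    (hF : Integrable F (volume.restrict (Ioo α β)))
    (h : ∀ φ, IsTest α β φ → ∫ x in Ioo α β, F x * deriv φ x = 0) :
    ∃ k, F =ᵐ[volume.restrict (Ioo α β)] fun _ => k := by
  obtain ⟨ρ, hρ, hρ1⟩ := exists_isTest_integral_eq_one hαβ
  -- The constant is the average of `F` against a bump `ρ` of unit mass: for every test function
  -- `φ`, the function `φ - (∫ φ) ρ` has mean zero, hence is a derivative and is annihilated by `F`.
  refine ⟨∫ x in Ioo α β, F x * ρ x, ?_⟩
  set k := ∫ x in Ioo α β, F x * ρ x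
  have hk : Integrable (fun _ : ℝ => k) (volume.restrict (Ioo α β)) := integrable_const k
  have := ae_eq_zero_of_integral_mul_isTest (hF.sub hk) (fun φ hφ => by
    obtain ⟨ψ, hψ, hψ'⟩ := exists_isTest_deriv_eq hαβ (hφ.sub_smul hρ (∫ x, φ x)) (by
      rw [integral_sub (hφ.continuous.integrable_of_hasCompactSupport hφ.compact)
        ((hρ.continuous.integrable_of_hasCompactSupport hρ.compact).const_mul _),
        integral_const_mul, hρ1]
      simp)
    have h1 := h ψ hψ
    rw [hψ'] at h1
    have e1 : ∀ x, F x * (φ x - (∫ x, φ x) * ρ x) = F x * φ x - (∫ x, φ x) * (F x * ρ x) :=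
      fun x => by ring
    simp_rw [e1] at h1
    rw [integral_sub (hφ.integrable_mul hF) ((hρ.integrable_mul hF).const_mul _),
      integral_const_mul] at h1
    simp_rw [Pi.sub_apply, sub_mul]
    rw [integral_sub (hφ.integrable_mul hF) (hφ.integrable_mul hk), hφ.setIntegral_eq (fun _ => k),
      integral_const_mul]
    linarith)
  filter_upwards [this] with x hx
  simpa [sub_eq_zero] using hx

lemma eqOn_Icc_of_ae_eq {X : Type*} [TopologicalSpace X] [T2Space X] {f g : ℝ → X} (hαβ : α < β)
    (hf : ContinuousOn f (Icc α β)) (hg : ContinuousOn g (Icc α β))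
    (h : f =ᵐ[volume.restrict (Ioo α β)] g) : EqOn f g (Icc α β) := by
  have h1 : EqOn f g (Ioo α β) :=
    Measure.eqOn_open_of_ae_eq h isOpen_Ioo (hf.mono Ioo_subset_Icc_self)
      (hg.mono Ioo_subset_Icc_self)
  refine h1.of_subset_closure hf hg Ioo_subset_Icc_self ?_
  rw [closure_Ioo hαβ.ne]

/-- A continuous function with an integrable distributional derivative is its primitive. -/
lemma eq_add_integral_of_weak_deriv (hαβ : α < β) {F h : ℝ → ℝ} (hF : ContinuousOn F (Icc α β))
    (hh : Integrable h (volume.restrict (Ioo α β)))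
    (H : ∀ φ, IsTest α β φ →
      ∫ t in Ioo α β, deriv φ t * F t = -∫ t in Ioo α β, φ t * h t) :
    ∀ t ∈ Icc α β, F t = F α + ∫ s in α..t, h s := by
  have hi := intervalIntegrable_of_integrable_Ioo hαβ.le hh
  have hc : ContinuousOn (fun t => ∫ s in α..t, h s) (Icc α β) := by
    have := intervalIntegral.continuousOn_primitive_interval' hi left_mem_uIcc
    rwa [uIcc_of_le hαβ.le] at this
  have hint : ∀ {f : ℝ → ℝ}, ContinuousOn f (Icc α β) →
      Integrable f (volume.restrict (Ioo α β)) := fun hf =>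
    (hf.integrableOn_Icc).mono_set Ioo_subset_Icc_self
  -- `F` minus the primitive of `h` has zero distributional derivative. It is constant a.e., then on
  -- the closed interval by continuity, and its value at `α` fixes the constant.
  obtain ⟨k, hk⟩ := ae_eq_const_of_integral_mul_deriv_isTest hαβ
    (F := fun t => F t - ∫ s in α..t, h s) (hint (hF.sub hc)) (fun φ hφ => by
      have h1 := H φ hφ
      rw [← integral_deriv_mul_primitive hαβ.le hφ hh] at h1
      simp_rw [mul_comm _ (deriv φ _), mul_sub]
      rw [integral_sub, h1, sub_self]
      · exact hint (hφ.continuous_deriv.continuousOn.mul hF)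
      · exact hint (hφ.continuous_deriv.continuousOn.mul hc))
  have h2 := eqOn_Icc_of_ae_eq hαβ (hF.sub hc) continuousOn_const hk
  intro t ht
  have h3 : F t - ∫ s in α..t, h s = k := h2 ht
  have h4 : F α - ∫ s in α..α, h s = k := h2 (left_mem_Icc.2 hαβ.le)
  simp only [intervalIntegral.integral_same, sub_zero] at h4
  linarith

/-- Transfers absolute continuity from a scalar primitive to any function whose increments it
dominates. -/
lemma AbsolutelyContinuousOnInterval.of_dist_le {X Y : Type*} [PseudoMetricSpace X]
    [PseudoMetricSpace Y] {f : ℝ → X} {g : ℝ → Y} {p q C : ℝ}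
    (hg : AbsolutelyContinuousOnInterval g p q)
    (h : ∀ s ∈ uIcc p q, ∀ t ∈ uIcc p q, dist (f s) (f t) ≤ C * dist (g s) (g t)) :
    AbsolutelyContinuousOnInterval f p q := by
  unfold AbsolutelyContinuousOnInterval at hg ⊢
  refine squeeze_zero' (Eventually.of_forall fun _ => Finset.sum_nonneg fun _ _ => dist_nonneg) ?_
    (by simpa using hg.const_mul C)
  rw [eventually_inf_principal]
  filter_upwards with (n, I) hnI
  simp only [Finset.mul_sum]
  refine Finset.sum_le_sum fun i hi => ?_
  exact h _ (hnI.1 i hi).1 _ (hnI.1 i hi).2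

end RealAnalysis

/-! ### Energy identity in a Hilbert space -/

section Energy

variable {E : Type*} [NormedAddCommGroup E] [InnerProductSpace ℝ E] [CompleteSpace E]

/-- The fundamental theorem of calculus for the square of an absolutely continuous function with
values in a Hilbert space. -/
lemma inner_primitive_eq (S : E →L[ℝ] E) (hS : ∀ x y, inner ℝ (S x) y = inner ℝ x (S y))
    {T : ℝ} {x : ℝ → E} (hx : IntervalIntegrable x volume 0 T) (y₀ : E) :
    inner ℝ (S (y₀ + ∫ s in (0 : ℝ)..T, x s)) (y₀ + ∫ s in (0 : ℝ)..T, x s) =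
      inner ℝ (S y₀) y₀ + 2 * ∫ t in (0 : ℝ)..T, inner ℝ (S (x t)) (y₀ + ∫ s in (0 : ℝ)..t, x s) := by
  set X : ℝ → E := fun t => y₀ + ∫ s in (0 : ℝ)..t, x s with hX
  have hXc : ContinuousOn X (uIcc 0 T) :=
    continuousOn_const.add (intervalIntegral.continuousOn_primitive_interval' hx left_mem_uIcc)
  obtain ⟨R, hR⟩ := isCompact_uIcc.exists_bound_of_continuousOn hXc
  have hsub : ∀ s ∈ uIcc 0 T, ∀ t ∈ uIcc 0 T, IntervalIntegrable x volume s t := fun s hs t ht =>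
    hx.mono_set (uIcc_subset_uIcc hs ht)
  have hN := hx.norm.absolutelyContinuousOnInterval_intervalIntegral (c := 0) left_mem_uIcc
  have hR0 : 0 ≤ R := (norm_nonneg _).trans (hR 0 left_mem_uIcc)
  -- The increments of `X` are controlled by those of the real function `t ↦ ∫₀ᵗ ‖x‖`, whose
  -- absolute continuity then passes to the quadratic expression. The factor `2 ‖S‖ R` comes from
  -- its two bilinear increments, with `‖X‖ ≤ R`.
  have hXd : ∀ s ∈ uIcc 0 T, ∀ t ∈ uIcc 0 T, ‖X s - X t‖ ≤
      dist (∫ r in (0 : ℝ)..s, ‖x r‖) (∫ r in (0 : ℝ)..t, ‖x r‖) := by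
    intro s hs t ht
    have h0 := fun r hr => hsub 0 left_mem_uIcc r hr
    rw [hX, add_sub_add_left_eq_sub, intervalIntegral.integral_interval_sub_left (h0 s hs) (h0 t ht),
      Real.dist_eq, intervalIntegral.integral_interval_sub_left (h0 s hs).norm (h0 t ht).norm]
    exact intervalIntegral.norm_integral_le_abs_integral_norm
  have hAC : AbsolutelyContinuousOnInterval (fun t => inner ℝ (S (X t)) (X t)) 0 T := by
    refine AbsolutelyContinuousOnInterval.of_dist_le (C := 2 * ‖S‖ * R) hN fun s hs t ht => ?_
    have h1 : inner ℝ (S (X s)) (X s) - inner ℝ (S (X t)) (X t) =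
        inner ℝ (S (X s - X t)) (X s) + inner ℝ (S (X t)) (X s - X t) := by
      rw [map_sub, inner_sub_left, inner_sub_right]; ring
    rw [Real.dist_eq, h1]
    have h2 : |inner ℝ (S (X s - X t)) (X s)| ≤ ‖S‖ * ‖X s - X t‖ * R :=
      (abs_real_inner_le_norm _ _).trans (mul_le_mul (S.le_opNorm _) (hR s hs) (norm_nonneg _)
        (by positivity))
    have h3 : |inner ℝ (S (X t)) (X s - X t)| ≤ ‖S‖ * R * ‖X s - X t‖ :=
      (abs_real_inner_le_norm _ _).trans (mul_le_mul_of_nonneg_right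
        ((S.le_opNorm _).trans (mul_le_mul_of_nonneg_left (hR t ht) (norm_nonneg _)))
        (norm_nonneg _))
    calc _ ≤ 2 * ‖S‖ * R * ‖X s - X t‖ := (abs_add_le _ _).trans (by linarith)
      _ ≤ _ := mul_le_mul_of_nonneg_left (hXd s hs t ht) (by positivity)
  have hFTC := hAC.integral_deriv_eq_sub
  have hd : ∫ t in (0 : ℝ)..T, deriv (fun t => inner ℝ (S (X t)) (X t)) t =
      ∫ t in (0 : ℝ)..T, 2 * inner ℝ (S (x t)) (X t) := by
    refine intervalIntegral.integral_congr_ae ?_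
    filter_upwards [hx.ae_hasDerivAt_integral] with t ht ht'
    have h1 : HasDerivAt X (x t) t :=
      (ht (uIoc_subset_uIcc ht') 0 left_mem_uIcc).const_add y₀
    have h2 := (S.hasFDerivAt.comp_hasDerivAt t h1).inner ℝ h1
    refine h2.deriv.trans ?_
    simp only [Function.comp]
    -- Symmetry of `S` merges the two terms of the product rule into `2 ⟨S x, X⟩`.
    rw [hS, real_inner_comm]
    ring
  rw [hd, intervalIntegral.integral_const_mul] at hFTC
  have h0 : X 0 = y₀ := by simp [hX]
  simp only [h0] at hFTC
  linarith

end Energy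

/-! ### Estimates and multiplication operators on `L²` -/

section L2Space

/-- Hölder's inequality on an interval of length `T`. Since `L2` is `L2Time 1 ℝ` by definition, the
case `T = 1` also serves the space variable. -/
lemma integral_norm_le_sqrt_mul_norm {X : Type} [NormedAddCommGroup X] {T : ℝ} (hT : 0 ≤ T)
    (F : L2Time T X) : ∫ t in Ioo (0 : ℝ) T, ‖F t‖ ≤ √T * ‖F‖ := by
  have h1 := eLpNorm_le_eLpNorm_mul_rpow_measure_univ (p := 1) (q := 2) (by norm_num)
    (Lp.memLp F).1
  have h2 : eLpNorm F 1 (volume.restrict (Ioo (0 : ℝ) T)) =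
      ENNReal.ofReal (∫ t in Ioo (0 : ℝ) T, ‖F t‖) := by
    rw [eLpNorm_one_eq_lintegral_enorm, ofReal_integral_norm_eq_lintegral_enorm]
    exact (Lp.memLp F).integrable (by norm_num)
  rw [h2, Measure.restrict_apply_univ, Real.volume_Ioo, sub_zero] at h1
  have h3 := ENNReal.toReal_mono (ENNReal.mul_ne_top (Lp.eLpNorm_ne_top F)
    (ENNReal.rpow_ne_top_of_nonneg (by norm_num) ENNReal.ofReal_ne_top)) h1
  rw [ENNReal.toReal_ofReal (integral_nonneg fun _ => norm_nonneg _), ENNReal.toReal_mul,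
    ← Lp.norm_def, ← ENNReal.toReal_rpow, ENNReal.toReal_ofReal hT] at h3
  rw [Real.sqrt_eq_rpow, mul_comm]
  norm_num at h3 ⊢
  exact h3

lemma integrable_L2Time {X : Type} [NormedAddCommGroup X] {T : ℝ} (F : L2Time T X) :
    Integrable F (volume.restrict (Ioo (0 : ℝ) T)) :=
  (Lp.memLp F).integrable (by norm_num)

lemma inner_L2_eq (F G : L2) : inner ℝ F G = ∫ x in Ioo (0 : ℝ) 1, F x * G x := by
  rw [L2.inner_def]
  refine integral_congr_ae (Eventually.of_forall fun x => ?_)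
  simp [mul_comm]

lemma integrable_L2_mul (F G : L2) :
    Integrable (fun x => F x * G x) (volume.restrict (Ioo (0 : ℝ) 1)) :=
  (Lp.memLp F).integrable_mul (Lp.memLp G)

lemma exists_mul_L2 {c : ℝ → ℝ} {C : ℝ}
    (hc : AEStronglyMeasurable c (volume.restrict (Ioo (0 : ℝ) 1)))
    (hC : ∀ᵐ x ∂volume.restrict (Ioo (0 : ℝ) 1), |c x| ≤ C) :
    ∃ M : L2 →L[ℝ] L2, ∀ F : L2,
      M F =ᵐ[volume.restrict (Ioo (0 : ℝ) 1)] fun x => c x * F x := by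
  have hb : ∀ F : L2, ∀ᵐ x ∂volume.restrict (Ioo (0 : ℝ) 1), ‖c x * F x‖ ≤ C * ‖F x‖ := by
    intro F
    filter_upwards [hC] with x hx
    rw [norm_mul]
    exact mul_le_mul_of_nonneg_right hx (norm_nonneg _)
  have hm : ∀ F : L2, MemLp (fun x => c x * F x) 2 (volume.restrict (Ioo (0 : ℝ) 1)) := fun F =>
    (Lp.memLp F).of_le_mul (hc.mul (Lp.memLp F).1) (hb F)
  let M : L2 →ₗ[ℝ] L2 :=
    { toFun := fun F => (hm F).toLp _
      map_add' := fun F G => by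
        ext1
        filter_upwards [(hm (F + G)).coeFn_toLp, (hm F).coeFn_toLp, (hm G).coeFn_toLp,
          Lp.coeFn_add F G, Lp.coeFn_add ((hm F).toLp _) ((hm G).toLp _)] with x h1 h2 h3 h4 h5
        rw [h1, h5, Pi.add_apply, h2, h3, h4, Pi.add_apply, mul_add]
      map_smul' := fun r F => by
        ext1
        filter_upwards [(hm (r • F)).coeFn_toLp, (hm F).coeFn_toLp,
          Lp.coeFn_smul r F, Lp.coeFn_smul r ((hm F).toLp _)] with x h1 h2 h3 h4
        simp only [RingHom.id_apply]
        rw [h1, h4, Pi.smul_apply, h2, h3, Pi.smul_apply, smul_eq_mul, smul_eq_mul]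
        ring }
  refine ⟨M.mkContinuous C fun F => ?_, fun F => (hm F).coeFn_toLp⟩
  refine Lp.norm_le_mul_norm_of_ae_le_mul ?_
  filter_upwards [hb F, (hm F).coeFn_toLp] with x h1 h2
  exact (congrArg norm h2).le.trans h1

/-- Multiplication by the characteristic function of a measurable set. -/
lemma exists_control {ω : Set ℝ} (hω : MeasurableSet ω) :
    ∃ B : L2 →L[ℝ] L2, ∀ (f : L2) (v : H10), controlPairing ω f v = inner ℝ (B f) (toL2 v) := by
  obtain ⟨B, hB⟩ := exists_mul_L2 (c := ω.indicator 1) (C := 1)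
    ((measurable_one.indicator hω).aestronglyMeasurable)
    (Eventually.of_forall fun x => by by_cases h : x ∈ ω <;> simp [h])
  refine ⟨B, fun f v => ?_⟩
  rw [inner_L2_eq, controlPairing]
  refine integral_congr_ae ?_
  filter_upwards [hB f] with x hx
  rw [hx]
  by_cases h : x ∈ ω <;> simp [h]

end L2Space

/-! ### The space `H¹₀(0,1)` -/

section Sobolev

/-- The embedding of `H¹₀` into `L²`. -/
def toL2L : H10 →L[ℝ] L2 := (WithLp.fstL 2 ℝ L2 L2).comp H10.subtypeL

/-- The weak derivative as a bounded operator. -/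
def weakDxL : H10 →L[ℝ] L2 := (WithLp.sndL 2 ℝ L2 L2).comp H10.subtypeL

@[simp] lemma toL2L_apply (u : H10) : toL2L u = toL2 u := rfl

@[simp] lemma weakDxL_apply (u : H10) : weakDxL u = weakDx u := rfl

instance : CompleteSpace H10 :=
  (Submodule.isClosed_topologicalClosure testGraph).completeSpace_coe

lemma norm_sq_H10 (u : H10) : ‖u‖ ^ 2 = ‖toL2 u‖ ^ 2 + ‖weakDx u‖ ^ 2 :=
  WithLp.prod_norm_sq_eq_of_L2 (u : WithLp 2 (L2 × L2))

lemma IsTest.memLp {φ : ℝ → ℝ} (hφ : IsTest 0 1 φ) :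
    MemLp φ 2 (volume.restrict (Ioo (0 : ℝ) 1)) :=
  (hφ.continuous.memLp_of_hasCompactSupport hφ.compact).restrict _

lemma IsTest.memLp_deriv {φ : ℝ → ℝ} (hφ : IsTest 0 1 φ) :
    MemLp (deriv φ) 2 (volume.restrict (Ioo (0 : ℝ) 1)) :=
  (hφ.continuous_deriv.memLp_of_hasCompactSupport hφ.compact.deriv).restrict _

lemma IsTest.exists_H10 {φ : ℝ → ℝ} (hφ : IsTest 0 1 φ) :
    ∃ u : H10, toL2 u =ᵐ[volume.restrict (Ioo (0 : ℝ) 1)] φ ∧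
      weakDx u =ᵐ[volume.restrict (Ioo (0 : ℝ) 1)] deriv φ := by
  have h : WithLp.toLp 2 (hφ.memLp.toLp φ, hφ.memLp_deriv.toLp _) ∈ testGraph :=
    ⟨φ, hφ, hφ.memLp.coeFn_toLp, hφ.memLp_deriv.coeFn_toLp⟩
  exact ⟨⟨_, Submodule.le_topologicalClosure _ h⟩, hφ.memLp.coeFn_toLp,
    hφ.memLp_deriv.coeFn_toLp⟩

/-- The Poincaré inequality. -/
lemma norm_toL2_le_norm_weakDx (u : H10) : ‖toL2 u‖ ≤ ‖weakDx u‖ := by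
  -- The inequality is a closed condition on pairs, so test functions suffice. For them `|φ(x)| ≤
  -- ∫₀¹ |φ'| ≤ ‖φ'‖`, and the unit length of the interval gives the constant `1`.
  have hcl : IsClosed {p : WithLp 2 (L2 × L2) | ‖p.fst‖ ≤ ‖p.snd‖} :=
    isClosed_le (WithLp.fstL 2 ℝ L2 L2).continuous.norm (WithLp.sndL 2 ℝ L2 L2).continuous.norm
  have hsub : (testGraph : Set (WithLp 2 (L2 × L2))) ⊆ {p | ‖p.fst‖ ≤ ‖p.snd‖} := by
    rintro p ⟨φ, hφ, h1, h2⟩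
    have hb : ∀ᵐ x ∂volume.restrict (Ioo (0 : ℝ) 1), ‖p.fst x‖ ≤ ‖p.snd‖ := by
      filter_upwards [h1, ae_restrict_mem measurableSet_Ioo] with x hx hx'
      rw [hx]
      have h3 : φ x = ∫ s in (0 : ℝ)..x, deriv φ s := by
        rw [intervalIntegral.integral_deriv_eq_sub (fun y _ => hφ.differentiable y)
          (hφ.continuous_deriv.intervalIntegrable _ _), hφ.eq_zero left_notMem_Ioo, sub_zero]
      rw [h3]
      have hi : IntegrableOn (fun s => ‖deriv φ s‖) (Ioc 0 1) :=
        (hφ.continuous_deriv.norm.intervalIntegrable 0 1).1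
      calc ‖∫ s in (0 : ℝ)..x, deriv φ s‖ ≤ ∫ s in (0 : ℝ)..x, ‖deriv φ s‖ :=
            intervalIntegral.norm_integral_le_integral_norm hx'.1.le
        _ ≤ ∫ s in (0 : ℝ)..1, ‖deriv φ s‖ := by
            rw [intervalIntegral.integral_of_le hx'.1.le, intervalIntegral.integral_of_le zero_le_one]
            exact setIntegral_mono_set hi (Eventually.of_forall fun _ => norm_nonneg _)
              (Ioc_subset_Ioc_right hx'.2.le).eventuallyLE
        _ = ∫ s in Ioo (0 : ℝ) 1, ‖p.snd s‖ := by
            rw [intervalIntegral_eq_Ioo _ zero_le_one]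
            refine integral_congr_ae ?_
            filter_upwards [h2] with s hs
            rw [hs]
        _ ≤ √1 * ‖p.snd‖ := integral_norm_le_sqrt_mul_norm zero_le_one p.snd
        _ = ‖p.snd‖ := by simp
    have := Lp.norm_le_of_ae_bound (norm_nonneg p.snd) hb
    simpa [measureUnivNNReal] using! this
  exact closure_minimal hsub hcl u.2

lemma norm_H10_sq_le (u : H10) : ‖u‖ ^ 2 ≤ 2 * ‖weakDx u‖ ^ 2 := by
  have := norm_toL2_le_norm_weakDx u
  rw [norm_sq_H10]
  nlinarith [norm_nonneg (toL2 u)]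

/-- This is the density of `H¹₀` in `L²`: test functions already separate. -/
lemma eq_zero_of_forall_inner_toL2 {F : L2} (h : ∀ v : H10, inner ℝ F (toL2 v) = 0) : F = 0 := by
  rw [Lp.eq_zero_iff_ae_eq_zero]
  refine ae_eq_zero_of_integral_mul_isTest (integrable_L2Time (T := 1) F) fun φ hφ => ?_
  obtain ⟨u, hu, -⟩ := hφ.exists_H10
  refine Eq.trans ?_ ((inner_L2_eq F (toL2 u)).symm.trans (h u))
  refine integral_congr_ae ?_
  filter_upwards [hu] with x hx
  rw [hx]

end Sobolev

/-! ### The elliptic problem and its flux -/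

section Elliptic

/-- Measurable coefficients with `0 < a₀ ≤ c ≤ a₁` a.e. in `(0,1)`. -/
structure IsElliptic (c : ℝ → ℝ) (a₀ a₁ : ℝ) : Prop where
  pos : 0 < a₀
  meas : AEStronglyMeasurable c (volume.restrict (Ioo (0 : ℝ) 1))
  bdd : ∀ᵐ x ∂volume.restrict (Ioo (0 : ℝ) 1), a₀ ≤ c x ∧ c x ≤ a₁

variable {c : ℝ → ℝ} {a₀ a₁ : ℝ}

lemma IsElliptic.abs_le (hc : IsElliptic c a₀ a₁) :
    ∀ᵐ x ∂volume.restrict (Ioo (0 : ℝ) 1), |c x| ≤ a₁ := by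
  filter_upwards [hc.bdd] with x hx
  rw [abs_of_pos (hc.pos.trans_le hx.1)]
  exact hx.2

lemma IsElliptic.exists_form (hc : IsElliptic c a₀ a₁) :
    ∃ A : H10 →L[ℝ] StrongDual ℝ H10, ∀ u v, A u v = diffusionForm c u v := by
  obtain ⟨M, hM⟩ := exists_mul_L2 hc.meas hc.abs_le
  refine ⟨((innerSL ℝ : L2 →L[ℝ] L2 →L[ℝ] ℝ).bilinearComp (M.comp weakDxL) weakDxL),
    fun u v => ?_⟩
  simp only [ContinuousLinearMap.bilinearComp_apply, innerSL_apply_apply,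
    ContinuousLinearMap.comp_apply, weakDxL_apply]
  rw [inner_L2_eq, diffusionForm]
  refine integral_congr_ae ?_
  filter_upwards [hM (weakDx u)] with x hx
  rw [hx]

/-- The form `∫ c u_x v_x` as a bounded operator from `H¹₀` to its dual. -/
def IsElliptic.form (hc : IsElliptic c a₀ a₁) : H10 →L[ℝ] StrongDual ℝ H10 :=
  Classical.choose hc.exists_form

lemma IsElliptic.form_apply (hc : IsElliptic c a₀ a₁) (u v : H10) :
    hc.form u v = diffusionForm c u v :=
  Classical.choose_spec hc.exists_form u v

lemma diffusionForm_comm (c : ℝ → ℝ) (u v : H10) : diffusionForm c u v = diffusionForm c v u := by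
  unfold diffusionForm
  congr 1
  ext x
  ring

lemma IsElliptic.integrable_form (hc : IsElliptic c a₀ a₁) (F G : L2) :
    Integrable (fun x => c x * F x * G x) (volume.restrict (Ioo (0 : ℝ) 1)) := by
  simp_rw [mul_assoc]
  exact (integrable_L2_mul F G).bdd_mul hc.meas hc.abs_le

lemma IsElliptic.le_diffusionForm (hc : IsElliptic c a₀ a₁) (u : H10) :
    a₀ * ‖weakDx u‖ ^ 2 ≤ diffusionForm c u u := by
  rw [← real_inner_self_eq_norm_sq, inner_L2_eq, ← integral_const_mul]
  refine integral_mono_ae ((integrable_L2_mul _ _).const_mul _) (hc.integrable_form _ _) ?_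
  filter_upwards [hc.bdd] with x hx
  rw [mul_assoc]
  exact mul_le_mul_of_nonneg_right hx.1 (mul_self_nonneg _)

lemma IsElliptic.isCoercive (hc : IsElliptic c a₀ a₁) : IsCoercive hc.form := by
  -- The `2` comes from `‖u‖² ≤ 2 ‖u_x‖²`.
  refine ⟨a₀ / 2, by have := hc.pos; positivity, fun u => ?_⟩
  rw [hc.form_apply]
  refine le_trans ?_ (hc.le_diffusionForm u)
  have := mul_le_mul_of_nonneg_left (norm_H10_sq_le u) hc.pos.le
  nlinarith

/-- The solution operator of `-(c u_x)_x = F` with homogeneous Dirichlet conditions. -/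
def IsElliptic.solve (hc : IsElliptic c a₀ a₁) : L2 →L[ℝ] H10 :=
  -- Lax–Milgram, applied to the Riesz representative in `H¹₀` of `v ↦ ⟨F, v⟩`, which the adjoint of
  -- the embedding supplies.
  (hc.isCoercive.continuousLinearEquivOfBilin.symm : H10 →L[ℝ] H10).comp
    (ContinuousLinearMap.adjoint toL2L)

lemma IsElliptic.diffusionForm_solve (hc : IsElliptic c a₀ a₁) (F : L2) (v : H10) :
    diffusionForm c (hc.solve F) v = inner ℝ F (toL2 v) := by
  rw [← hc.form_apply, ← hc.isCoercive.continuousLinearEquivOfBilin_apply]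
  simp only [IsElliptic.solve, ContinuousLinearMap.comp_apply, ContinuousLinearEquiv.coe_coe,
    ContinuousLinearEquiv.apply_symm_apply]
  rw [ContinuousLinearMap.adjoint_inner_left, toL2L_apply]

lemma IsElliptic.eq_solve (hc : IsElliptic c a₀ a₁) {F : L2} {u : H10}
    (h : ∀ v, diffusionForm c u v = inner ℝ F (toL2 v)) : u = hc.solve F := by
  have h1 : diffusionForm c (u - hc.solve F) (u - hc.solve F) = 0 := by
    rw [← hc.form_apply, map_sub hc.form, sub_apply, hc.form_apply, hc.form_apply, h,
      hc.diffusionForm_solve, sub_self]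
  have h2 := hc.le_diffusionForm (u - hc.solve F)
  have h3 := norm_H10_sq_le (u - hc.solve F)
  have h4 : ‖u - hc.solve F‖ ^ 2 ≤ 0 := by
    have h5 : a₀ * ‖u - hc.solve F‖ ^ 2 ≤ 0 := by
      nlinarith [hc.pos]
    by_contra h6
    push Not at h6
    nlinarith [mul_pos hc.pos h6]
  rw [← sub_eq_zero, ← norm_eq_zero]
  exact pow_eq_zero_iff (two_ne_zero) |>.1 (le_antisymm h4 (sq_nonneg _))

/-- The solution operator as an operator on `L²`. -/
def IsElliptic.inv (hc : IsElliptic c a₀ a₁) : L2 →L[ℝ] L2 := toL2L.comp hc.solve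

lemma IsElliptic.inv_apply (hc : IsElliptic c a₀ a₁) (F : L2) : hc.inv F = toL2 (hc.solve F) := rfl

lemma IsElliptic.inner_inv (hc : IsElliptic c a₀ a₁) (F G : L2) :
    inner ℝ (hc.inv F) G = diffusionForm c (hc.solve F) (hc.solve G) := by
  rw [diffusionForm_comm, hc.diffusionForm_solve, real_inner_comm, hc.inv_apply]

lemma IsElliptic.inv_symm (hc : IsElliptic c a₀ a₁) (F G : L2) :
    inner ℝ (hc.inv F) G = inner ℝ F (hc.inv G) := by
  rw [hc.inner_inv, hc.diffusionForm_solve, hc.inv_apply]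

/-- The bound is by the quadratic form of the inverse rather than by `‖F‖²`. That form is the
dissipation in the parabolic energy identity, so this is what places heat solutions in
`L²(0,T;H¹₀)`. -/
lemma IsElliptic.norm_solve_sq_le (hc : IsElliptic c a₀ a₁) (F : L2) :
    ‖hc.solve F‖ ^ 2 ≤ 2 / a₀ * inner ℝ (hc.inv F) F := by
  rw [hc.inner_inv]
  have h1 := hc.le_diffusionForm (hc.solve F)
  have h2 := norm_H10_sq_le (hc.solve F)
  have h3 := hc.pos
  rw [div_mul_eq_mul_div, le_div_iff₀ h3]
  nlinarith

lemma IsElliptic.inv_nonneg (hc : IsElliptic c a₀ a₁) (F : L2) : 0 ≤ inner ℝ (hc.inv F) F := by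
  rw [hc.inner_inv]
  exact (mul_nonneg hc.pos.le (sq_nonneg _)).trans (hc.le_diffusionForm _)

/-- If the solution vanishes, then `F` is orthogonal to `H¹₀`, which is dense. -/
lemma IsElliptic.inv_injective (hc : IsElliptic c a₀ a₁) {F : L2} (h : hc.inv F = 0) : F = 0 := by
  have h1 := hc.norm_solve_sq_le F
  rw [h, inner_zero_left, mul_zero] at h1
  have h2 : hc.solve F = 0 := by
    rw [← norm_eq_zero]
    exact pow_eq_zero_iff (two_ne_zero) |>.1 (le_antisymm h1 (sq_nonneg _))
  refine eq_zero_of_forall_inner_toL2 fun v => ?_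
  rw [← hc.diffusionForm_solve, h2, ← hc.form_apply, map_zero, zero_apply]

lemma IsElliptic.norm_weakDx_solve_le (hc : IsElliptic c a₀ a₁) (F : L2) :
    ‖weakDx (hc.solve F)‖ ≤ ‖F‖ / a₀ := by
  have h1 := hc.le_diffusionForm (hc.solve F)
  rw [hc.diffusionForm_solve] at h1
  have h2 := (real_inner_le_norm F (toL2 (hc.solve F))).trans
    (mul_le_mul_of_nonneg_left (norm_toL2_le_norm_weakDx _) (norm_nonneg _))
  have h3 := hc.pos
  rw [le_div_iff₀ h3]
  rcases (norm_nonneg (weakDx (hc.solve F))).eq_or_lt with h | h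
  · rw [← h, zero_mul]; exact norm_nonneg _
  · nlinarith

lemma abs_primitive_le (F : L2) {x : ℝ} (hx : x ∈ Icc (0 : ℝ) 1) :
    |∫ s in (0 : ℝ)..x, F s| ≤ ‖F‖ := by
  have hi := (intervalIntegrable_of_integrable_Ioo zero_le_one (integrable_L2Time (T := 1) F)).norm.1
  calc ‖∫ s in (0 : ℝ)..x, F s‖ ≤ ∫ s in (0 : ℝ)..x, ‖F s‖ :=
        intervalIntegral.norm_integral_le_integral_norm hx.1
    _ ≤ ∫ s in (0 : ℝ)..1, ‖F s‖ := by
        rw [intervalIntegral.integral_of_le hx.1, intervalIntegral.integral_of_le zero_le_one]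
        exact setIntegral_mono_set hi (Eventually.of_forall fun _ => norm_nonneg _)
          (Ioc_subset_Ioc_right hx.2).eventuallyLE
    _ ≤ √1 * ‖F‖ := by
        rw [intervalIntegral_eq_Ioo _ zero_le_one]
        exact integral_norm_le_sqrt_mul_norm zero_le_one (X := ℝ) F
    _ = ‖F‖ := by simp

lemma primitive_absolutelyContinuous (F : L2) :
    AbsolutelyContinuousOnInterval (fun x => ∫ s in (0 : ℝ)..x, F s) 0 1 :=
  (intervalIntegrable_of_integrable_Ioo zero_le_one
    (integrable_L2Time (T := 1) F)).absolutelyContinuousOnInterval_intervalIntegral left_mem_uIcc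

/-- The flux `c u_x` is a primitive of `-F`. -/
lemma IsElliptic.exists_flux (hc : IsElliptic c a₀ a₁) (F : L2) :
    ∃ k : ℝ, |k| ≤ (a₁ / a₀ + 1) * ‖F‖ ∧
      (fun x => c x * weakDx (hc.solve F) x) =ᵐ[volume.restrict (Ioo (0 : ℝ) 1)]
        fun x => k - ∫ s in (0 : ℝ)..x, F s := by
  obtain ⟨M, hM⟩ := exists_mul_L2 hc.meas hc.abs_le
  set w := weakDx (hc.solve F) with hw
  have hc01 : ContinuousOn (fun x => ∫ s in (0 : ℝ)..x, F s) (Icc 0 1) := by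
    have := (primitive_absolutelyContinuous F).continuousOn
    rwa [uIcc_of_le zero_le_one] at this
  have hPi : Integrable (fun x => ∫ s in (0 : ℝ)..x, F s) (volume.restrict (Ioo (0 : ℝ) 1)) :=
    hc01.integrableOn_Icc.mono_set Ioo_subset_Icc_self
  have hMi : Integrable (M w) (volume.restrict (Ioo (0 : ℝ) 1)) := integrable_L2Time (T := 1) _
  have hσi : Integrable (fun x => c x * w x) (volume.restrict (Ioo (0 : ℝ) 1)) :=
    hMi.congr (hM w)
  -- The weak equation reads `∫ c u_x φ' = ∫ F φ = -∫ (∫₀ˣ F) φ'`, so `c u_x + ∫₀ˣ F` is constant by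
  -- du Bois-Reymond.
  obtain ⟨k, hk⟩ := ae_eq_const_of_integral_mul_deriv_isTest zero_lt_one
    (F := fun x => c x * w x + ∫ s in (0 : ℝ)..x, F s) (hσi.add hPi) (fun φ hφ => by
      obtain ⟨v, hv, hv'⟩ := hφ.exists_H10
      have h1 := hc.diffusionForm_solve F v
      rw [diffusionForm, inner_L2_eq] at h1
      have h2 : ∫ x in Ioo (0 : ℝ) 1, c x * w x * deriv φ x = ∫ x in Ioo (0 : ℝ) 1, φ x * F x := by
        calc _ = ∫ x in Ioo (0 : ℝ) 1, c x * w x * weakDx v x := by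
              refine integral_congr_ae ?_
              filter_upwards [hv'] with x hx
              rw [hx]
          _ = _ := h1.trans (by
              refine integral_congr_ae ?_
              filter_upwards [hv] with x hx
              rw [hx, mul_comm])
      have h3 := integral_deriv_mul_primitive zero_le_one hφ (integrable_L2Time (T := 1) F)
      obtain ⟨C, hC⟩ := hφ.compact.deriv.exists_bound_of_continuous hφ.continuous_deriv
      simp_rw [add_mul]
      rw [integral_add, h2]
      · simp_rw [mul_comm _ (deriv φ _)]
        rw [h3, add_neg_cancel]
      · exact hσi.mul_bdd (c := C) hφ.continuous_deriv.aestronglyMeasurable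
          (Eventually.of_forall hC)
      · exact hPi.mul_bdd (c := C) hφ.continuous_deriv.aestronglyMeasurable
          (Eventually.of_forall hC))
  refine ⟨k, ?_, ?_⟩
  -- Averaging over the unit interval gives `|k| ≤ a₁ ∫ |u_x| + ‖F‖`, and `‖u_x‖ ≤ ‖F‖ / a₀`.
  · have h1 : |k| = ∫ x in Ioo (0 : ℝ) 1, |k| := by simp
    have hwi : Integrable (fun x => ‖w x‖) (volume.restrict (Ioo (0 : ℝ) 1)) :=
      (integrable_L2Time (T := 1) w).norm
    have h2 : ∫ x in Ioo (0 : ℝ) 1, |k| ≤ ∫ x in Ioo (0 : ℝ) 1, (a₁ * ‖w x‖ + ‖F‖) := by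
      refine integral_mono_ae (integrable_const _) ((hwi.const_mul a₁).add (integrable_const _)) ?_
      filter_upwards [hk, hc.abs_le, ae_restrict_mem measurableSet_Ioo] with x hx hx' hx''
      rw [← hx]
      refine (abs_add_le _ _).trans (add_le_add ?_ (abs_primitive_le F (Ioo_subset_Icc_self hx'')))
      rw [abs_mul]
      exact mul_le_mul_of_nonneg_right hx' (abs_nonneg _)
    have h3 : ∫ x in Ioo (0 : ℝ) 1, (a₁ * ‖w x‖ + ‖F‖) =
        a₁ * (∫ x in Ioo (0 : ℝ) 1, ‖w x‖) + ‖F‖ := by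
      rw [integral_add (hwi.const_mul a₁) (integrable_const _), integral_const_mul]
      simp
    have h4 : ∫ x in Ioo (0 : ℝ) 1, ‖w x‖ ≤ ‖F‖ / a₀ :=
      (integral_norm_le_sqrt_mul_norm zero_le_one (X := ℝ) w).trans
        (by simpa using hc.norm_weakDx_solve_le F)
    have h5 : 0 ≤ a₁ := by
      have : (ae (volume.restrict (Ioo (0 : ℝ) 1))).NeBot := by
        rw [ae_neBot, Ne, Measure.restrict_eq_zero]
        simp
      obtain ⟨x, hx⟩ := hc.abs_le.exists
      exact (abs_nonneg _).trans hx
    rw [h1]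
    refine h2.trans (h3.le.trans ?_)
    have := mul_le_mul_of_nonneg_left h4 h5
    calc _ ≤ a₁ * (‖F‖ / a₀) + ‖F‖ := by linarith
      _ = _ := by ring
  · filter_upwards [hk] with x hx
    linarith

end Elliptic

/-! ### Dependence of the inverse on the coefficient -/

section Perturbation

variable {c₁ c₂ : ℝ → ℝ} {a₀ a₁ : ℝ}

/-- Testing each problem with the solution of the other gives `∫ (c₂ - c₁) u_x v_x`, and `c₂ - c₁ =
(1/c₁ - 1/c₂) c₁ c₂`. Written this way, the rough gradients are replaced by absolutely continuous
fluxes. -/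
lemma IsElliptic.inner_inv_sub_inv (h₁ : IsElliptic c₁ a₀ a₁) (h₂ : IsElliptic c₂ a₀ a₁)
    (F G : L2) : inner ℝ (h₁.inv F - h₂.inv F) G =
      ∫ x in Ioo (0 : ℝ) 1, (1 / c₁ x - 1 / c₂ x) * ((c₁ x * weakDx (h₁.solve F) x) *
        (c₂ x * weakDx (h₂.solve G) x)) := by
  have e1 : inner ℝ (h₁.inv F) G = diffusionForm c₂ (h₁.solve F) (h₂.solve G) := by
    rw [diffusionForm_comm, h₂.diffusionForm_solve, real_inner_comm, h₁.inv_apply]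
  have e2 : inner ℝ (h₂.inv F) G = diffusionForm c₁ (h₁.solve F) (h₂.solve G) := by
    rw [h₁.diffusionForm_solve, h₂.inv_symm, h₂.inv_apply]
  rw [inner_sub_left, e1, e2, diffusionForm, diffusionForm,
    ← integral_sub (h₂.integrable_form _ _) (h₁.integrable_form _ _)]
  refine integral_congr_ae ?_
  filter_upwards [h₁.bdd, h₂.bdd] with x hx hx'
  have p1 : c₁ x ≠ 0 := (h₁.pos.trans_le hx.1).ne'
  have p2 : c₂ x ≠ 0 := (h₁.pos.trans_le hx'.1).ne'
  field_simp

/-- Only the primitive of `b` is small, so the derivative is moved onto the product of the two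
fluxes, each bounded by `κ + 1` times the norm of its datum. The boundary term at `1` contributes
`(κ + 1)²`, and each term of the product rule contributes `κ + 1`. -/
lemma abs_integral_mul_primitives_le {b : ℝ → ℝ} {δ : ℝ}
    (hb : Integrable b (volume.restrict (Ioo (0 : ℝ) 1)))
    (hδ : ∀ x ∈ Icc (0 : ℝ) 1, |∫ s in (0 : ℝ)..x, b s| ≤ δ) {κ k l : ℝ} (F G : L2)
    (hk : |k| ≤ κ * ‖F‖) (hl : |l| ≤ κ * ‖G‖) :
    |∫ x in Ioo (0 : ℝ) 1, b x * ((k - ∫ s in (0 : ℝ)..x, F s) * (l - ∫ s in (0 : ℝ)..x, G s))| ≤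
      δ * ((κ + 1) ^ 2 + 2 * (κ + 1)) * ‖F‖ * ‖G‖ := by
  have hδ0 : 0 ≤ δ := (abs_nonneg _).trans (hδ 0 (left_mem_Icc.2 zero_le_one))
  have hprim : ∀ {k : ℝ} {F : L2}, |k| ≤ κ * ‖F‖ → ∀ x ∈ Icc (0 : ℝ) 1,
      |k - ∫ s in (0 : ℝ)..x, F s| ≤ (κ + 1) * ‖F‖ := fun {k F} hk x hx => by
    have := abs_primitive_le F hx
    rw [add_one_mul]
    exact (abs_sub _ _).trans (add_le_add hk this)
  set f : ℝ → ℝ := fun x => k - ∫ s in (0 : ℝ)..x, F s with hf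
  set g : ℝ → ℝ := fun x => l - ∫ s in (0 : ℝ)..x, G s with hg
  have hconst : ∀ k : ℝ, AbsolutelyContinuousOnInterval (fun _ : ℝ => k) 0 1 := fun k =>
    contDiffOn_const.absolutelyContinuousOnInterval
  have hfAC : AbsolutelyContinuousOnInterval f 0 1 :=
    (hconst k).sub (primitive_absolutelyContinuous F)
  have hgAC : AbsolutelyContinuousOnInterval g 0 1 :=
    (hconst l).sub (primitive_absolutelyContinuous G)
  have hbI := intervalIntegrable_of_integrable_Ioo zero_le_one hb
  have hbAC := hbI.absolutelyContinuousOnInterval_intervalIntegral (c := 0) left_mem_uIcc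
  have hIBP := (hfAC.fun_mul hgAC).integral_mul_deriv_eq_deriv_mul hbAC
  have e1 : ∫ x in Ioo (0 : ℝ) 1, b x * (f x * g x) =
      ∫ x in (0 : ℝ)..1, f x * g x * deriv (fun x => ∫ s in (0 : ℝ)..x, b s) x := by
    rw [intervalIntegral_eq_Ioo _ zero_le_one]
    refine integral_congr_ae ?_
    filter_upwards [deriv_intervalIntegral_ae zero_le_one hb] with x hx
    rw [hx, mul_comm]
  have hFi : Integrable F (volume.restrict (Ioo (0 : ℝ) 1)) := integrable_L2Time (T := 1) F
  have hGi : Integrable G (volume.restrict (Ioo (0 : ℝ) 1)) := integrable_L2Time (T := 1) G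
  have hd : ∀ᵐ x ∂volume.restrict (Ioo (0 : ℝ) 1),
      |deriv (fun x => f x * g x) x * ∫ s in (0 : ℝ)..x, b s| ≤
        δ * ((κ + 1) * ‖G‖ * ‖F x‖ + (κ + 1) * ‖F‖ * ‖G x‖) := by
    have hF' := (intervalIntegrable_of_integrable_Ioo zero_le_one hFi).ae_hasDerivAt_integral
    have hG' := (intervalIntegrable_of_integrable_Ioo zero_le_one hGi).ae_hasDerivAt_integral
    filter_upwards [ae_restrict_of_ae hF', ae_restrict_of_ae hG',
      ae_restrict_mem measurableSet_Ioo] with x h1 h2 h3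
    have hx : x ∈ Icc (0 : ℝ) 1 := Ioo_subset_Icc_self h3
    have hx' : x ∈ uIcc (0 : ℝ) 1 := by rwa [uIcc_of_le zero_le_one]
    have d1 : HasDerivAt f (-F x) x := (h1 hx' 0 left_mem_uIcc).const_sub k
    have d2 : HasDerivAt g (-G x) x := (h2 hx' 0 left_mem_uIcc).const_sub l
    rw [(d1.fun_mul d2).deriv, abs_mul, mul_comm]
    refine mul_le_mul (hδ x hx) ?_ (abs_nonneg _) hδ0
    refine (abs_add_le _ _).trans (add_le_add ?_ ?_)
    · rw [abs_mul, abs_neg, mul_comm]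
      exact mul_le_mul_of_nonneg_right (hprim hl x hx) (abs_nonneg _)
    · rw [abs_mul, abs_neg]
      exact mul_le_mul_of_nonneg_right (hprim hk x hx) (abs_nonneg _)
  have hI : |∫ x in (0 : ℝ)..1, deriv (fun x => f x * g x) x * ∫ s in (0 : ℝ)..x, b s| ≤
      δ * ((κ + 1) * ‖G‖ * ‖F‖ + (κ + 1) * ‖F‖ * ‖G‖) := by
    rw [intervalIntegral_eq_Ioo _ zero_le_one]
    have hint : Integrable (fun x => δ * ((κ + 1) * ‖G‖ * ‖F x‖ + (κ + 1) * ‖F‖ * ‖G x‖))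
        (volume.restrict (Ioo (0 : ℝ) 1)) := ((hFi.norm.const_mul ((κ + 1) * ‖G‖)).add
      (hGi.norm.const_mul ((κ + 1) * ‖F‖))).const_mul δ
    refine (norm_integral_le_of_norm_le
      (f := fun x => deriv (fun x => f x * g x) x * ∫ s in (0 : ℝ)..x, b s) hint hd).trans ?_
    rw [integral_const_mul, integral_add (hFi.norm.const_mul _) (hGi.norm.const_mul _),
      integral_const_mul, integral_const_mul]
    have n1 : ∫ x in Ioo (0 : ℝ) 1, ‖F x‖ ≤ ‖F‖ := by
      simpa using integral_norm_le_sqrt_mul_norm zero_le_one (X := ℝ) F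
    have n2 : ∫ x in Ioo (0 : ℝ) 1, ‖G x‖ ≤ ‖G‖ := by
      simpa using integral_norm_le_sqrt_mul_norm zero_le_one (X := ℝ) G
    have p1 : 0 ≤ (κ + 1) * ‖F‖ := (abs_nonneg _).trans (hprim hk 0 (left_mem_Icc.2 zero_le_one))
    have p2 : 0 ≤ (κ + 1) * ‖G‖ := (abs_nonneg _).trans (hprim hl 0 (left_mem_Icc.2 zero_le_one))
    gcongr
  have h1mem : (1 : ℝ) ∈ Icc (0 : ℝ) 1 := right_mem_Icc.2 zero_le_one
  have hB : |f 1 * g 1 * ∫ s in (0 : ℝ)..1, b s| ≤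
      ((κ + 1) * ‖F‖) * ((κ + 1) * ‖G‖) * δ := by
    rw [abs_mul, abs_mul]
    have p1 := hprim hk 1 h1mem
    have p2 := hprim hl 1 h1mem
    exact mul_le_mul (mul_le_mul p1 p2 (abs_nonneg _) ((abs_nonneg _).trans p1)) (hδ 1 h1mem)
      (abs_nonneg _) (mul_nonneg ((abs_nonneg _).trans p1) ((abs_nonneg _).trans p2))
  rw [e1, hIBP, intervalIntegral.integral_same, mul_zero, sub_zero]
  refine (abs_sub _ _).trans ((add_le_add hB hI).trans (le_of_eq ?_))
  ring

/-- The solution operator depends on the coefficient only through the primitive of `1 / c`. -/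
lemma IsElliptic.norm_inv_sub_inv_le (h₁ : IsElliptic c₁ a₀ a₁) (h₂ : IsElliptic c₂ a₀ a₁)
    {δ : ℝ} (hδ : ∀ x ∈ Icc (0 : ℝ) 1, |∫ s in (0 : ℝ)..x, (1 / c₁ s - 1 / c₂ s)| ≤ δ) :
    ‖h₁.inv - h₂.inv‖ ≤ δ * ((a₁ / a₀ + 2) ^ 2 + 2 * (a₁ / a₀ + 2)) := by
  have hinv : ∀ {c : ℝ → ℝ}, IsElliptic c a₀ a₁ →
      Integrable (fun x => 1 / c x) (volume.restrict (Ioo (0 : ℝ) 1)) := fun {c} hc => by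
    refine (integrable_const (1 / a₀)).mono' ?_ ?_
    · simp_rw [one_div]
      exact hc.meas.aemeasurable.inv.aestronglyMeasurable
    · filter_upwards [hc.bdd] with x hx
      rw [Real.norm_eq_abs, abs_of_pos (one_div_pos.2 (hc.pos.trans_le hx.1))]
      exact one_div_le_one_div_of_le hc.pos hx.1
  have hb := (hinv h₁).sub (hinv h₂)
  have key : ∀ F G : L2, |inner ℝ (h₁.inv F - h₂.inv F) G| ≤
      δ * ((a₁ / a₀ + 2) ^ 2 + 2 * (a₁ / a₀ + 2)) * ‖F‖ * ‖G‖ := fun F G => by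
    obtain ⟨k, hk, hk'⟩ := h₁.exists_flux F
    obtain ⟨l, hl, hl'⟩ := h₂.exists_flux G
    have := abs_integral_mul_primitives_le hb hδ F G hk hl
    rw [h₁.inner_inv_sub_inv h₂]
    have e : a₁ / a₀ + 1 + 1 = a₁ / a₀ + 2 := by ring
    rw [e] at this
    refine le_trans (le_of_eq ?_) this
    congr 1
    refine integral_congr_ae ?_
    filter_upwards [hk', hl'] with x hx hx'
    rw [← hx, ← hx']
    rfl
  have hδ0 : 0 ≤ δ := (abs_nonneg _).trans (hδ 0 (left_mem_Icc.2 zero_le_one))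
  have hC : 0 ≤ (a₁ / a₀ + 2) ^ 2 + 2 * (a₁ / a₀ + 2) := by
    have h01 : 0 ≤ a₁ / a₀ := by
      have : (ae (volume.restrict (Ioo (0 : ℝ) 1))).NeBot := by
        rw [ae_neBot, Ne, Measure.restrict_eq_zero]
        simp
      obtain ⟨x, hx⟩ := h₁.abs_le.exists
      exact div_nonneg ((abs_nonneg _).trans hx) h₁.pos.le
    positivity
  refine ContinuousLinearMap.opNorm_le_bound _ (mul_nonneg hδ0 hC) fun F => ?_
  -- Taking `G` to be the difference itself turns the bilinear bound into an operator-norm bound.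
  have h := key F (h₁.inv F - h₂.inv F)
  rw [real_inner_self_eq_norm_sq, abs_of_nonneg (sq_nonneg _), sq] at h
  rw [sub_apply]
  rcases (norm_nonneg (h₁.inv F - h₂.inv F)).eq_or_lt with h0 | h0
  · rw [← h0]
    have := mul_nonneg hδ0 hC
    positivity
  · exact le_of_mul_le_mul_right h h0

end Perturbation

/-! ### Periodic oscillation and the harmonic mean -/

section Oscillation

/-- The primitive of a periodic function of mean zero is bounded. -/
lemma exists_bound_primitive_of_periodic {b : ℝ → ℝ} (hb : Function.Periodic b 1)
    (hi : ∀ p q, IntervalIntegrable b volume p q) (h0 : ∫ x in (0 : ℝ)..1, b x = 0) :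
    ∃ C, ∀ t, |∫ x in (0 : ℝ)..t, b x| ≤ C := by
  have hc : Continuous fun t => ∫ x in (0 : ℝ)..t, b x :=
    intervalIntegral.continuous_primitive hi 0
  obtain ⟨C, hC⟩ := (isCompact_Icc (a := (0 : ℝ)) (b := 1)).exists_bound_of_continuousOn
    hc.continuousOn
  -- Mean zero makes the primitive periodic, so its bound on `[0,1]` is global.
  have hper : Function.Periodic (fun t => ∫ x in (0 : ℝ)..t, b x) 1 := fun t => by
    have h1 := hb.intervalIntegral_add_eq t 0
    rw [zero_add, h0] at h1
    simp only []
    rw [← intervalIntegral.integral_add_adjacent_intervals (hi 0 t) (hi t (t + 1)), h1, add_zero]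
  refine ⟨C, fun t => ?_⟩
  obtain ⟨s, hs, hs'⟩ := hper.exists_mem_Ico₀ one_pos t
  have := hC s (Ico_subset_Icc_self hs)
  rwa [← hs'] at this

variable {a : ℝ → ℝ} {a₀ a₁ : ℝ}

lemma isElliptic_oscCoeff (ha_meas : AEStronglyMeasurable a volume) (ha₀ : 0 < a₀)
    (ha_bdd : ∀ᵐ x ∂(volume : Measure ℝ), a₀ ≤ a x ∧ a x ≤ a₁) {ε : ℝ} (hε : 0 < ε) :
    IsElliptic (oscCoeff a ε) a₀ a₁ := by
  have hq : Measure.QuasiMeasurePreserving (fun x : ℝ => x / ε) volume volume := by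
    refine ⟨measurable_id.div_const ε, ?_⟩
    have h := Real.map_volume_mul_right (inv_ne_zero hε.ne')
    simp_rw [div_eq_mul_inv]
    rw [h]
    exact Measure.smul_absolutelyContinuous
  exact ⟨ha₀, (ha_meas.comp_quasiMeasurePreserving hq).restrict,
    ae_restrict_of_ae (hq.ae ha_bdd)⟩

lemma integrable_one_div (ha_meas : AEStronglyMeasurable a volume) (ha₀ : 0 < a₀)
    (ha_bdd : ∀ᵐ x ∂(volume : Measure ℝ), a₀ ≤ a x ∧ a x ≤ a₁) (p q : ℝ) :
    IntervalIntegrable (fun x => 1 / a x) volume p q := by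
  refine (intervalIntegrable_const (c := 1 / a₀)).mono_fun' ?_ ?_
  · simp_rw [one_div]
    exact ha_meas.aemeasurable.inv.aestronglyMeasurable.restrict
  · filter_upwards [ae_restrict_of_ae ha_bdd] with x hx
    rw [Real.norm_eq_abs, abs_of_pos (one_div_pos.2 (ha₀.trans_le hx.1))]
    exact one_div_le_one_div_of_le ha₀ hx.1

/-- A harmonic mean lies between the bounds of the function. The perturbation estimate needs both
coefficients to share `a₀` and `a₁`. -/
lemma isElliptic_homCoeff (ha_meas : AEStronglyMeasurable a volume) (ha₀ : 0 < a₀)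
    (ha_bdd : ∀ᵐ x ∂(volume : Measure ℝ), a₀ ≤ a x ∧ a x ≤ a₁) :
    IsElliptic (homCoeff a) a₀ a₁ := by
  have ha₁ : 0 < a₁ := by
    obtain ⟨x, hx⟩ := ha_bdd.exists
    exact ha₀.trans_le (hx.1.trans hx.2)
  have hi : Integrable (fun x => 1 / a x) (volume.restrict (Ioo (0 : ℝ) 1)) := by
    have := integrable_one_div ha_meas ha₀ ha_bdd 0 1
    rwa [intervalIntegrable_iff_integrableOn_Ioo_of_le zero_le_one] at this
  have hvol : ∀ k : ℝ, ∫ x in Ioo (0 : ℝ) 1, k = k := fun k => by simp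
  have h1 : ∫ x in Ioo (0 : ℝ) 1, 1 / a x ≤ 1 / a₀ := by
    rw [← hvol (1 / a₀)]
    refine integral_mono_ae hi (integrable_const _) ?_
    filter_upwards [ae_restrict_of_ae ha_bdd] with x hx
    exact one_div_le_one_div_of_le ha₀ hx.1
  have h2 : 1 / a₁ ≤ ∫ x in Ioo (0 : ℝ) 1, 1 / a x := by
    rw [← hvol (1 / a₁)]
    refine integral_mono_ae (integrable_const _) hi ?_
    filter_upwards [ae_restrict_of_ae ha_bdd] with x hx
    exact one_div_le_one_div_of_le (ha₀.trans_le hx.1) hx.2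
  have h3 : 0 < 1 / a₁ := one_div_pos.2 ha₁
  refine ⟨ha₀, aestronglyMeasurable_const, Eventually.of_forall fun x => ⟨?_, ?_⟩⟩
  · rw [homCoeff]
    rw [one_div] at h1
    exact (le_inv_comm₀ (h3.trans_le h2) ha₀).1 h1
  · rw [homCoeff]
    rw [one_div] at h2 h3
    exact inv_le_of_inv_le₀ ha₁ h2

/-- Homogenization in dimension one: the solution operators converge in norm. -/
lemma exists_norm_inv_sub_inv_le (ha_meas : AEStronglyMeasurable a volume)
    (ha_per : Function.Periodic a 1) (ha₀ : 0 < a₀)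
    (ha_bdd : ∀ᵐ x ∂(volume : Measure ℝ), a₀ ≤ a x ∧ a x ≤ a₁) :
    ∃ C, ∀ ε (hε : 0 < ε), ‖(isElliptic_oscCoeff ha_meas ha₀ ha_bdd hε).inv -
      (isElliptic_homCoeff ha_meas ha₀ ha_bdd).inv‖ ≤ C * ε := by
  set m := ∫ x in Ioo (0 : ℝ) 1, 1 / a x with hm
  have hi := integrable_one_div ha_meas ha₀ ha_bdd
  obtain ⟨C, hC⟩ := exists_bound_primitive_of_periodic (b := fun x => 1 / a x - m)
    (fun x => by simp only []; rw [ha_per x]) (fun p q => (hi p q).sub intervalIntegrable_const) (by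
      rw [intervalIntegral.integral_sub (hi 0 1) intervalIntegrable_const,
        intervalIntegral_eq_Ioo _ zero_le_one, ← hm]
      simp)
  refine ⟨C * ((a₁ / a₀ + 2) ^ 2 + 2 * (a₁ / a₀ + 2)), fun ε hε => ?_⟩
  refine ((isElliptic_oscCoeff ha_meas ha₀ ha_bdd hε).norm_inv_sub_inv_le
    (isElliptic_homCoeff ha_meas ha₀ ha_bdd) (δ := C * ε) fun x hx => ?_).trans (le_of_eq (by ring))
  have e : ∀ s, 1 / oscCoeff a ε s - 1 / homCoeff a s = (fun x => 1 / a x - m) (s / ε) := by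
    intro s
    simp [oscCoeff, homCoeff, hm]
  simp_rw [e]
  -- Rescaling turns the primitive at `x` into `ε` times the bounded primitive at `x / ε`: this is
  -- the rate.
  rw [intervalIntegral.integral_comp_div (fun x => 1 / a x - m) hε.ne', zero_div, smul_eq_mul,
    abs_mul, abs_of_pos hε, mul_comm]
  exact mul_le_mul_of_nonneg_right (hC _) hε.le

end Oscillation

/-! ### The operators `S (S + K)⁻¹` and `K (S + K)⁻¹` -/

section AccretivePair

variable {E : Type*} [NormedAddCommGroup E] [InnerProductSpace ℝ E]

lemma denseRange_of_forall_inner_eq_zero [CompleteSpace E] (M : E →L[ℝ] E)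
    (h : ∀ z, (∀ x, inner ℝ (M x) z = 0) → z = 0) : DenseRange M := by
  have h1 : M.rangeᗮ = ⊥ := by
    rw [Submodule.eq_bot_iff]
    exact fun z hz => h z fun x => (Submodule.mem_orthogonal _ _).1 hz _ ⟨x, rfl⟩
  have h2 := (Submodule.topologicalClosure_eq_top_iff).2 h1
  rw [DenseRange, dense_iff_closure_eq]
  simpa using! congrArg (fun s : Submodule ℝ E => (s : Set E)) h2

/-- Commuting operators `S`, `K` with `S` symmetric and injective, such that the angle between
`S x` and `K x` is never obtuse. -/
structure IsAccretivePair (S K : E →L[ℝ] E) : Prop where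
  symm : ∀ x y, inner ℝ (S x) y = inner ℝ x (S y)
  inj : ∀ x, S x = 0 → x = 0
  comm : ∀ x, S (K x) = K (S x)
  nonneg : ∀ x, 0 ≤ inner ℝ (S x) (K x)

namespace IsAccretivePair

variable {S K : E →L[ℝ] E}

/-- The cross term is nonnegative. Hence `S x` and `K x` are both dominated by `(S + K) x`, which
makes the two quotients contractions. -/
lemma norm_sq_add_le (h : IsAccretivePair S K) (x : E) :
    ‖S x‖ ^ 2 + ‖K x‖ ^ 2 ≤ ‖S x + K x‖ ^ 2 := by
  rw [norm_add_sq_real]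
  linarith [h.nonneg x]

lemma norm_left_le (h : IsAccretivePair S K) (x : E) : ‖S x‖ ≤ 1 * ‖(S + K) x‖ := by
  rw [one_mul, add_apply]
  exact (pow_le_pow_iff_left₀ (norm_nonneg _) (norm_nonneg _) two_ne_zero).1
    (by linarith [h.norm_sq_add_le x, sq_nonneg ‖K x‖])

lemma norm_right_le (h : IsAccretivePair S K) (x : E) : ‖K x‖ ≤ ‖(S + K) x‖ := by
  rw [add_apply]
  exact (pow_le_pow_iff_left₀ (norm_nonneg _) (norm_nonneg _) two_ne_zero).1
    (by linarith [h.norm_sq_add_le x, sq_nonneg ‖S x‖])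

lemma add_injective (h : IsAccretivePair S K) {x : E} (hx : (S + K) x = 0) : x = 0 := by
  have := h.norm_left_le x
  rw [hx, norm_zero, mul_zero] at this
  exact h.inj x (norm_le_zero_iff.1 this)

variable [CompleteSpace E]

lemma denseRange_add (h : IsAccretivePair S K) : DenseRange (S + K) := by
  refine denseRange_of_forall_inner_eq_zero _ fun z hz => h.inj z ?_
  -- Testing orthogonality with `S z` gives `‖S z‖² + ⟨S z, K z⟩ = 0` by symmetry and commutation.
  have h1 := hz (S z)
  rw [add_apply, inner_add_left, h.symm, real_inner_self_eq_norm_sq, ← h.comm, h.symm,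
    real_inner_comm] at h1
  have h2 := h.nonneg z
  rw [← norm_eq_zero]
  exact pow_eq_zero_iff (two_ne_zero) |>.1 (le_antisymm (by linarith) (sq_nonneg _))

/-- The bounded operator `S (S + K)⁻¹`. -/
def fst (_ : IsAccretivePair S K) : E →L[ℝ] E :=
  (S : E →ₗ[ℝ] E).extendOfNorm ((S + K : E →L[ℝ] E) : E →ₗ[ℝ] E)

/-- The bounded operator `K (S + K)⁻¹`. -/
def snd (h : IsAccretivePair S K) : E →L[ℝ] E := ContinuousLinearMap.id ℝ E - h.fst

lemma fst_add (h : IsAccretivePair S K) (x : E) : h.fst ((S + K) x) = S x :=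
  LinearMap.extendOfNorm_eq (f := (S : E →ₗ[ℝ] E)) (e := ((S + K : E →L[ℝ] E) : E →ₗ[ℝ] E))
    h.denseRange_add ⟨1, h.norm_left_le⟩ x

lemma norm_fst_le (h : IsAccretivePair S K) (x : E) : ‖h.fst x‖ ≤ ‖x‖ :=
  (LinearMap.norm_extendOfNorm_apply_le (f := (S : E →ₗ[ℝ] E))
    (e := ((S + K : E →L[ℝ] E) : E →ₗ[ℝ] E)) h.denseRange_add 1 h.norm_left_le x).trans_eq
    (one_mul _)

lemma fst_add_snd (h : IsAccretivePair S K) (x : E) : h.fst x + h.snd x = x := by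
  simp [snd]

lemma snd_add (h : IsAccretivePair S K) (x : E) : h.snd ((S + K) x) = K x := by
  have := h.fst_add_snd ((S + K) x)
  rw [h.fst_add, add_apply] at this
  simpa using this

lemma norm_snd_le (h : IsAccretivePair S K) (x : E) : ‖h.snd x‖ ≤ ‖x‖ := by
  refine h.denseRange_add.induction_on x (isClosed_le (by fun_prop) (by fun_prop)) fun y => ?_
  rw [h.snd_add]
  exact h.norm_right_le y

/-- Both sides are `S K (S + K)⁻¹ x` on the dense range. For the heat equation with force `x`, this
common value is the state, `h.fst x` is its time derivative and `h.snd x` its elliptic part. -/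
lemma left_snd (h : IsAccretivePair S K) (x : E) : S (h.snd x) = K (h.fst x) := by
  refine h.denseRange_add.induction_on x (isClosed_eq (by fun_prop) (by fun_prop)) fun y => ?_
  rw [h.snd_add, h.fst_add, h.comm]

lemma fst_right (h : IsAccretivePair S K) (x : E) : h.fst (K x) = K (h.fst x) := by
  refine h.denseRange_add.induction_on x (isClosed_eq (by fun_prop) (by fun_prop)) fun y => ?_
  have : K ((S + K) y) = (S + K) (K y) := by simp [h.comm]
  rw [this, h.fst_add, h.fst_add, h.comm]

lemma fst_left (h : IsAccretivePair S K) (x : E) : h.fst (S x) = S (h.fst x) := by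
  refine h.denseRange_add.induction_on x (isClosed_eq (by fun_prop) (by fun_prop)) fun y => ?_
  have : S ((S + K) y) = (S + K) (S y) := by simp [h.comm]
  rw [this, h.fst_add, h.fst_add]

/-- An identity of resolvent type: two contractions flank `S - S'`, so norm convergence of `S`
passes to `K S (S + K)⁻¹`. For `S (S + K)⁻¹` alone only strong convergence is established, in
`tendsto_fst`. -/
lemma right_fst_sub {S' : E →L[ℝ] E} (h : IsAccretivePair S K) (h' : IsAccretivePair S' K)
    (x : E) : K (h.fst x) - K (h'.fst x) = h.snd ((S - S') (h'.snd x)) := by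
  have e1 : h.snd (S (h'.snd x)) = K (h.fst (h'.snd x)) := by
    rw [← h.left_snd]
    simp [snd, h.fst_left]
  have e2 : h.snd (S' (h'.snd x)) = K (h'.fst x) - K (h.fst (h'.fst x)) := by
    rw [h'.left_snd]
    simp [snd, h.fst_right]
  rw [sub_apply, map_sub, e1, e2]
  have e3 : h'.snd x = x - h'.fst x := by simp [snd]
  rw [e3, map_sub, map_sub]
  abel

lemma norm_right_comp_fst_sub_le {S' : E →L[ℝ] E} (h : IsAccretivePair S K)
    (h' : IsAccretivePair S' K) : ‖K.comp h.fst - K.comp h'.fst‖ ≤ ‖S - S'‖ := by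
  refine ContinuousLinearMap.opNorm_le_bound _ (norm_nonneg _) fun x => ?_
  rw [sub_apply, ContinuousLinearMap.comp_apply, ContinuousLinearMap.comp_apply,
    h.right_fst_sub h']
  exact (h.norm_snd_le _).trans (((S - S').le_opNorm _).trans
    (mul_le_mul_of_nonneg_left (h'.norm_snd_le x) (norm_nonneg _)))

lemma tendsto_fst {ι : Type*} {l : Filter ι} {S' : ι → E →L[ℝ] E} (h : IsAccretivePair S K)
    (h' : ∀ i, IsAccretivePair (S' i) K) (hl : Tendsto S' l (𝓝 S)) (x : E) :
    Tendsto (fun i => (h' i).fst x) l (𝓝 (h.fst x)) := by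
  rw [Metric.tendsto_nhds]
  intro η hη
  obtain ⟨y, hy⟩ := h.denseRange_add.exists_dist_lt x (show (0 : ℝ) < η / 3 by positivity)
  rw [dist_eq_norm] at hy
  have h1 : Tendsto (fun i => 2 * (‖S' i - S‖ * ‖y‖)) l (𝓝 0) := by
    have := ((tendsto_iff_norm_sub_tendsto_zero.1 hl).mul_const ‖y‖).const_mul 2
    simpa using this
  filter_upwards [h1.eventually_lt_const (show (0 : ℝ) < η / 3 by positivity)] with i hi
  -- On the dense range, `(S + K) y = (S' i + K) y - (S' i - S) y`, and `(h' i).fst` sends the first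
  -- summand to `S' i y`. The outer terms are below `η / 3` by contractivity, the middle one is at
  -- most `2 ‖S' i - S‖ ‖y‖`.
  have e : (h' i).fst x - h.fst x = (h' i).fst (x - (S + K) y) + ((S' i - S) y -
      (h' i).fst ((S' i - S) y)) - h.fst (x - (S + K) y) := by
    have e1 : (h' i).fst ((S' i - S) y) = S' i y - (h' i).fst ((S + K) y) := by
      rw [← (h' i).fst_add, ← map_sub]
      simp
    rw [e1, map_sub, map_sub, h.fst_add, sub_apply]
    abel
  rw [dist_eq_norm, e]
  have b1 := (h' i).norm_fst_le (x - (S + K) y)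
  have b2 := h.norm_fst_le (x - (S + K) y)
  have b3 := (h' i).norm_fst_le ((S' i - S) y)
  have b4 := (S' i - S).le_opNorm y
  have b5 := norm_sub_le ((h' i).fst (x - (S + K) y) + ((S' i - S) y -
      (h' i).fst ((S' i - S) y))) (h.fst (x - (S + K) y))
  have b6 := norm_add_le ((h' i).fst (x - (S + K) y)) ((S' i - S) y - (h' i).fst ((S' i - S) y))
  have b7 := norm_sub_le ((S' i - S) y) ((h' i).fst ((S' i - S) y))
  linarith

end IsAccretivePair

end AccretivePair

/-! ### Stability of quadratic minimization -/

section QuadraticMinimization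

lemma tendsto_clm_apply {X Y ι : Type*} [NormedAddCommGroup X] [NormedSpace ℝ X]
    [NormedAddCommGroup Y] [NormedSpace ℝ Y] {l : Filter ι} {L' : ι → X →L[ℝ] Y} {L : X →L[ℝ] Y}
    {x' : ι → X} {x : X} (hL : Tendsto L' l (𝓝 L)) (hx : Tendsto x' l (𝓝 x)) :
    Tendsto (fun i => L' i (x' i)) l (𝓝 (L x)) :=
  (isBoundedBilinearMap_apply.continuous.tendsto (L, x)).comp (hL.prodMk_nhds hx)

variable {E F : Type*} [NormedAddCommGroup E] [InnerProductSpace ℝ E] [CompleteSpace E]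
  [NormedAddCommGroup F] [InnerProductSpace ℝ F] [CompleteSpace F]

open ContinuousLinearMap (adjoint)

/-- The equation is `(1 + L*L) f = -L*b`, and `1 + L*L` is coercive with constant `1`. -/
lemma exists_eulerLagrange (L : E →L[ℝ] F) (b : F) : ∃ f, f + adjoint L (L f + b) = 0 := by
  let B : E →L[ℝ] E →L[ℝ] ℝ :=
    (innerSL ℝ : E →L[ℝ] E →L[ℝ] ℝ) + (innerSL ℝ : F →L[ℝ] F →L[ℝ] ℝ).bilinearComp L L
  have hBa : ∀ u v, B u v = inner ℝ u v + inner ℝ (L u) (L v) := fun _ _ => rfl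
  have hB : IsCoercive B := ⟨1, one_pos, fun u => by
    rw [hBa, real_inner_self_eq_norm_sq, real_inner_self_eq_norm_sq]
    nlinarith [sq_nonneg ‖L u‖]⟩
  refine ⟨hB.continuousLinearEquivOfBilin.symm (-adjoint L b), ?_⟩
  set f := hB.continuousLinearEquivOfBilin.symm (-adjoint L b) with hf
  refine ext_inner_right ℝ fun v => ?_
  have h1 := hB.continuousLinearEquivOfBilin_apply f v
  rw [hf, ContinuousLinearEquiv.apply_symm_apply, ← hf] at h1
  rw [hBa, inner_neg_left, ContinuousLinearMap.adjoint_inner_left] at h1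
  rw [inner_add_left, ContinuousLinearMap.adjoint_inner_left, inner_add_left, inner_zero_left]
  linarith

/-- Exact second-order expansion at a critical point: the linear term vanishes, and the remainder
yields minimality and uniqueness at once. -/
lemma quadratic_eq_of_eulerLagrange {L : E →L[ℝ] F} {b : F} {f : E}
    (hf : f + adjoint L (L f + b) = 0) (g : E) :
    ‖g‖ ^ 2 + ‖L g + b‖ ^ 2 =
      ‖f‖ ^ 2 + ‖L f + b‖ ^ 2 + ‖g - f‖ ^ 2 + ‖L (g - f)‖ ^ 2 := by
  have h1 : inner ℝ f (g - f) + inner ℝ (L f + b) (L (g - f)) = 0 := by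
    rw [← ContinuousLinearMap.adjoint_inner_left, ← inner_add_left, hf, inner_zero_left]
  have h2 : ‖g‖ ^ 2 = ‖f‖ ^ 2 + 2 * inner ℝ f (g - f) + ‖g - f‖ ^ 2 := by
    rw [← norm_add_sq_real, add_sub_cancel]
  have h3 : ‖L g + b‖ ^ 2 =
      ‖L f + b‖ ^ 2 + 2 * inner ℝ (L f + b) (L (g - f)) + ‖L (g - f)‖ ^ 2 := by
    rw [← norm_add_sq_real, map_sub]
    congr 2
    abel
  rw [h2, h3]
  linarith

/-- Minimizers of `‖f‖² + ‖L f + b‖²` are the solutions of the Euler-Lagrange equation. -/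
lemma isMin_iff_eulerLagrange (L : E →L[ℝ] F) (b : F) (f : E) :
    (∀ g, ‖f‖ ^ 2 + ‖L f + b‖ ^ 2 ≤ ‖g‖ ^ 2 + ‖L g + b‖ ^ 2) ↔ f + adjoint L (L f + b) = 0 := by
  constructor
  · intro h
    obtain ⟨f', hf'⟩ := exists_eulerLagrange L b
    have h1 := quadratic_eq_of_eulerLagrange hf' f
    have h2 := h f'
    have h3 : ‖f - f'‖ ^ 2 = 0 :=
      le_antisymm (by linarith [sq_nonneg ‖L (f - f')‖]) (sq_nonneg _)
    have h4 : f = f' := by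
      rw [← sub_eq_zero, ← norm_eq_zero]
      exact pow_eq_zero_iff (two_ne_zero) |>.1 h3
    rw [h4, hf']
  · intro h g
    rw [quadratic_eq_of_eulerLagrange h g]
    linarith [sq_nonneg ‖L (g - f)‖, sq_nonneg ‖g - f‖]

lemma eulerLagrange_unique {L : E →L[ℝ] F} {b : F} {f g : E} (hf : f + adjoint L (L f + b) = 0)
    (hg : g + adjoint L (L g + b) = 0) : f = g := by
  have h1 := quadratic_eq_of_eulerLagrange hf g
  have h2 := quadratic_eq_of_eulerLagrange hg f
  rw [norm_sub_rev f g] at h2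
  have h3 : ‖g - f‖ ^ 2 = 0 :=
    le_antisymm (by linarith [sq_nonneg ‖L (g - f)‖, sq_nonneg ‖L (f - g)‖]) (sq_nonneg _)
  rw [eq_comm, ← sub_eq_zero, ← norm_eq_zero]
  exact pow_eq_zero_iff (two_ne_zero) |>.1 h3

/-- Minimizers of `‖f‖² + ‖L f + b‖²` depend continuously on `L` and `b`. -/
lemma tendsto_of_eulerLagrange {ι : Type*} {l : Filter ι} {L : E →L[ℝ] F} {b : F} {f : E}
    {L' : ι → E →L[ℝ] F} {b' : ι → F} {f' : ι → E} (hf : f + adjoint L (L f + b) = 0)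
    (hf' : ∀ i, f' i + adjoint (L' i) (L' i (f' i) + b' i) = 0) (hL : Tendsto L' l (𝓝 L))
    (hb : Tendsto b' l (𝓝 b)) : Tendsto f' l (𝓝 f) := by
  have hadj : Tendsto (fun i => adjoint (L' i)) l (𝓝 (adjoint L)) :=
    ((adjoint (𝕜 := ℝ) (E := E) (F := F)).continuous.tendsto L).comp hL
  -- This is the residual of the limit minimizer in the perturbed equation. Coercivity of `1 +
  -- L'*L'`, with constant `1` for every index, bounds `‖f' i - f‖` by it.
  have hr : Tendsto (fun i => f + adjoint (L' i) (L' i f + b' i)) l (𝓝 0) := by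
    rw [← hf]
    exact tendsto_const_nhds.add (tendsto_clm_apply hadj
      ((tendsto_clm_apply hL tendsto_const_nhds).add hb))
  rw [tendsto_iff_norm_sub_tendsto_zero]
  refine squeeze_zero (fun _ => norm_nonneg _) (fun i => ?_) (tendsto_zero_iff_norm_tendsto_zero.1 hr)
  set d := f' i - f with hd
  set r := f + adjoint (L' i) (L' i f + b' i) with hr'
  have h1 : d + adjoint (L' i) (L' i d) = -r := by
    have := hf' i
    rw [hd, hr', ← sub_eq_zero, ← this, map_sub, map_sub, map_add, map_add]
    abel
  have h2 : ‖d‖ ^ 2 + ‖L' i d‖ ^ 2 = -inner ℝ r d := by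
    rw [← inner_neg_left, ← h1, inner_add_left, ContinuousLinearMap.adjoint_inner_left,
      real_inner_self_eq_norm_sq, real_inner_self_eq_norm_sq]
  have h3 : -inner ℝ r d ≤ ‖r‖ * ‖d‖ := (neg_le_abs _).trans (abs_real_inner_le_norm _ _)
  rcases (norm_nonneg d).eq_or_lt with h | h
  · rw [← h]; exact norm_nonneg _
  · nlinarith [sq_nonneg ‖L' i d‖]

end QuadraticMinimization

/-! ### Bochner spaces, primitives and lifted operators -/

section TimeSpaces

variable {X Y : Type} [NormedAddCommGroup X] [NormedAddCommGroup Y] {T : ℝ}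

lemma memLp_IccExtend (hT : 0 ≤ T) (y : C(Icc (0 : ℝ) T, X)) :
    MemLp (IccExtend hT y) 2 (volume.restrict (Ioo (0 : ℝ) T)) :=
  MemLp.of_bound (Continuous.Icc_extend' y.continuous).aestronglyMeasurable ‖y‖
    (Eventually.of_forall fun _ => y.norm_coe_le_norm _)

lemma L2Time.intervalIntegrable (x : L2Time T X) {t : ℝ} (ht : t ∈ Icc (0 : ℝ) T) :
    IntervalIntegrable x volume 0 t :=
  (intervalIntegrable_of_integrable_Ioo (ht.1.trans ht.2) (integrable_L2Time x)).mono_set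
    (uIcc_subset_uIcc left_mem_uIcc (by rwa [uIcc_of_le (ht.1.trans ht.2)]))

variable [NormedSpace ℝ X] [NormedSpace ℝ Y]

/-- The pointwise action of a bounded operator on `L²(0,T;X)`. -/
def liftL2 (T : ℝ) (A : X →L[ℝ] Y) : L2Time T X →L[ℝ] L2Time T Y := A.compLpL 2 _

lemma coeFn_liftL2 (A : X →L[ℝ] Y) (x : L2Time T X) :
    ∀ᵐ t ∂volume.restrict (Ioo (0 : ℝ) T), liftL2 T A x t = A (x t) :=
  A.coeFn_compLpL x

lemma norm_liftL2_sub_le (A B : X →L[ℝ] Y) : ‖liftL2 T A - liftL2 T B‖ ≤ ‖A - B‖ := by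
  have : liftL2 T A - liftL2 T B = liftL2 T (A - B) := by
    rw [sub_eq_iff_eq_add, liftL2, liftL2, liftL2, ← ContinuousLinearMap.add_compLpL,
      sub_add_cancel]
  rw [this]
  exact ContinuousLinearMap.norm_compLpL_le _

/-- The embedding of `C([0,T];X)` into `L²(0,T;X)`. -/
def ofC (hT : 0 ≤ T) : C(Icc (0 : ℝ) T, X) →L[ℝ] L2Time T X :=
  LinearMap.mkContinuous
    { toFun := fun y => (memLp_IccExtend hT y).toLp _
      map_add' := fun y z => by
        rw [← MemLp.toLp_add]
        rfl
      map_smul' := fun r y => by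
        rw [RingHom.id_apply, ← MemLp.toLp_const_smul]
        rfl }
    ((measureUnivNNReal (volume.restrict (Ioo (0 : ℝ) T)) : ℝ) ^ ((2 : ENNReal).toReal)⁻¹)
    (fun y => Lp.norm_le_of_ae_bound (norm_nonneg y) (by
      filter_upwards [(memLp_IccExtend hT y).coeFn_toLp] with t ht
      exact (congrArg norm ht).le.trans (y.norm_coe_le_norm _)))

lemma coeFn_ofC (hT : 0 ≤ T) (y : C(Icc (0 : ℝ) T, X)) :
    ofC hT y =ᵐ[volume.restrict (Ioo (0 : ℝ) T)] IccExtend hT y :=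
  (memLp_IccExtend hT y).coeFn_toLp

lemma ofC_injective (hT : 0 < T) : Function.Injective (ofC (X := X) hT.le) := by
  intro y z h
  have h1 : IccExtend hT.le y =ᵐ[volume.restrict (Ioo (0 : ℝ) T)] IccExtend hT.le z := by
    refine (coeFn_ofC hT.le y).symm.trans ?_
    rw [h]
    exact coeFn_ofC hT.le z
  have h2 := eqOn_Icc_of_ae_eq hT (Continuous.Icc_extend' y.continuous).continuousOn
    (Continuous.Icc_extend' z.continuous).continuousOn h1
  ext1 t
  have h3 := h2 t.2
  rwa [IccExtend_val, IccExtend_val] at h3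

/-- Constant functions of time. -/
def constC (T : ℝ) : X →L[ℝ] C(Icc (0 : ℝ) T, X) :=
  LinearMap.mkContinuous
    { toFun := fun w => ContinuousMap.const _ w
      map_add' := fun _ _ => rfl
      map_smul' := fun _ _ => rfl } 1
    (fun w => by
      rw [one_mul]
      exact (ContinuousMap.norm_le _ (norm_nonneg w)).2 fun _ => le_rfl)

@[simp] lemma constC_apply (w : X) (t : Icc (0 : ℝ) T) : constC T w t = w := rfl

lemma intervalIntegral_congr_ae_Ioo {f g : ℝ → X} {t : ℝ} (ht : t ∈ Icc (0 : ℝ) T)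
    (h : ∀ᵐ s ∂volume.restrict (Ioo (0 : ℝ) T), f s = g s) :
    ∫ s in (0 : ℝ)..t, f s = ∫ s in (0 : ℝ)..t, g s := by
  rw [intervalIntegral_eq_Ioo _ ht.1, intervalIntegral_eq_Ioo _ ht.1]
  exact integral_congr_ae (ae_restrict_of_ae_restrict_of_subset (Ioo_subset_Ioo_right ht.2) h)

lemma norm_primitive_le (x : L2Time T X) {t : ℝ} (ht : t ∈ Icc (0 : ℝ) T) :
    ‖∫ s in (0 : ℝ)..t, x s‖ ≤ √T * ‖x‖ := by
  have hT := ht.1.trans ht.2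
  refine (intervalIntegral.norm_integral_le_integral_norm ht.1).trans
    (le_trans ?_ (integral_norm_le_sqrt_mul_norm hT x))
  rw [intervalIntegral_eq_Ioo _ ht.1]
  exact setIntegral_mono_set (integrable_L2Time x).norm (Eventually.of_forall fun _ => norm_nonneg _)
    (Ioo_subset_Ioo_right ht.2).eventuallyLE

lemma continuous_primitive_Icc (hT : 0 ≤ T) (x : L2Time T X) :
    Continuous fun t : Icc (0 : ℝ) T => ∫ s in (0 : ℝ)..t, x s := by
  have h := intervalIntegral.continuousOn_primitive_interval'
    (x.intervalIntegrable (right_mem_Icc.2 hT)) left_mem_uIcc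
  rw [uIcc_of_le hT] at h
  exact continuousOn_iff_continuous_domRestrict.1 h

/-- The primitive vanishing at `0`, from `L²(0,T;X)` to `C([0,T];X)`. -/
def primC (hT : 0 ≤ T) : L2Time T X →L[ℝ] C(Icc (0 : ℝ) T, X) :=
  LinearMap.mkContinuous
    { toFun := fun x => ⟨fun t => ∫ s in (0 : ℝ)..t, x s, continuous_primitive_Icc hT x⟩
      map_add' := fun x y => by
        ext1 t
        rw [ContinuousMap.add_apply]
        simp only [ContinuousMap.coe_mk]
        rw [← intervalIntegral.integral_add (x.intervalIntegrable t.2) (y.intervalIntegrable t.2)]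
        exact intervalIntegral_congr_ae_Ioo t.2 (Lp.coeFn_add x y)
      map_smul' := fun r x => by
        ext1 t
        rw [ContinuousMap.smul_apply]
        simp only [ContinuousMap.coe_mk, RingHom.id_apply]
        rw [← intervalIntegral.integral_smul]
        exact intervalIntegral_congr_ae_Ioo t.2 (Lp.coeFn_smul r x) } (√T)
    (fun x => (ContinuousMap.norm_le _ (by positivity)).2 fun t => norm_primitive_le x t.2)

lemma primC_apply (hT : 0 ≤ T) (x : L2Time T X) (t : Icc (0 : ℝ) T) :
    primC hT x t = ∫ s in (0 : ℝ)..t, x s := rfl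

/-- The primitive vanishing at `0`, as an operator on `L²(0,T;X)`. -/
def prim (hT : 0 ≤ T) : L2Time T X →L[ℝ] L2Time T X := (ofC hT).comp (primC hT)

lemma prim_apply (hT : 0 ≤ T) (x : L2Time T X) : prim hT x = ofC hT (primC hT x) := rfl

lemma coeFn_prim (hT : 0 ≤ T) (x : L2Time T X) :
    ∀ᵐ t ∂volume.restrict (Ioo (0 : ℝ) T), prim hT x t = ∫ s in (0 : ℝ)..t, x s := by
  filter_upwards [coeFn_ofC hT (primC hT x), ae_restrict_mem measurableSet_Ioo] with t ht ht'
  rw [prim_apply, ht, IccExtend_of_mem hT _ (Ioo_subset_Icc_self ht')]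
  rfl

lemma primC_liftL2 [CompleteSpace X] [CompleteSpace Y] (hT : 0 ≤ T) (A : X →L[ℝ] Y)
    (x : L2Time T X) (t : Icc (0 : ℝ) T) : primC hT (liftL2 T A x) t = A (primC hT x t) := by
  rw [primC_apply, primC_apply, ← A.intervalIntegral_comp_comm (x.intervalIntegrable t.2)]
  exact intervalIntegral_congr_ae_Ioo t.2 (coeFn_liftL2 A x)

lemma liftL2_ofC (hT : 0 ≤ T) (A : X →L[ℝ] Y) (y : C(Icc (0 : ℝ) T, X))
    (z : C(Icc (0 : ℝ) T, Y)) (h : ∀ t, z t = A (y t)) : liftL2 T A (ofC hT y) = ofC hT z := by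
  ext1
  filter_upwards [coeFn_liftL2 A (ofC hT y), coeFn_ofC hT y, coeFn_ofC hT z] with t h1 h2 h3
  rw [h1, h2, h3]
  exact (h _).symm

lemma liftL2_prim [CompleteSpace X] [CompleteSpace Y] (hT : 0 ≤ T) (A : X →L[ℝ] Y)
    (x : L2Time T X) : liftL2 T A (prim hT x) = prim hT (liftL2 T A x) :=
  liftL2_ofC hT A _ _ fun t => primC_liftL2 hT A x t

lemma liftL2_ofC_constC (hT : 0 ≤ T) (A : X →L[ℝ] Y) (w : X) :
    liftL2 T A (ofC hT (constC T w)) = ofC hT (constC T (A w)) :=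
  liftL2_ofC hT A _ _ fun _ => rfl

end TimeSpaces

/-! ### The evolution equation `S y' + y = 0` -/

section Parabolic

variable {X : Type} [NormedAddCommGroup X] [InnerProductSpace ℝ X] {T : ℝ}

/-- Bounded, symmetric, nonnegative and injective operators. -/
structure IsPosInjective (S : X →L[ℝ] X) : Prop where
  symm : ∀ x y, inner ℝ (S x) y = inner ℝ x (S y)
  nonneg : ∀ x, 0 ≤ inner ℝ (S x) x
  inj : ∀ x, S x = 0 → x = 0

lemma IsPosInjective.denseRange [CompleteSpace X] {S : X →L[ℝ] X} (h : IsPosInjective S) :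
    DenseRange S :=
  denseRange_of_forall_inner_eq_zero S fun z hz => h.inj z (by
    have := hz (S z)
    rw [h.symm] at this
    exact inner_self_eq_zero.1 this)

lemma IsPosInjective.integral_inner_nonneg {S : X →L[ℝ] X} (h : IsPosInjective S)
    (p : L2Time T X) {t : ℝ} (ht : t ∈ Icc (0 : ℝ) T) :
    0 ≤ ∫ s in (0 : ℝ)..t, inner ℝ (liftL2 T S p s) (p s) := by
  have : ∫ s in (0 : ℝ)..t, inner ℝ (liftL2 T S p s) (p s) =
      ∫ s in (0 : ℝ)..t, inner ℝ (S (p s)) (p s) := by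
    refine intervalIntegral_congr_ae_Ioo ht ?_
    filter_upwards [coeFn_liftL2 S p] with s hs
    rw [hs]
  rw [this]
  exact intervalIntegral.integral_nonneg ht.1 fun s _ => h.nonneg _

variable [CompleteSpace X]

/-- Accretivity is the energy identity: if `y` is the primitive of `x`, then `2 ∫₀ᵀ ⟨S x, y⟩ = ⟨S
y(T), y(T)⟩ ≥ 0`. -/
lemma IsPosInjective.isAccretivePair {S : X →L[ℝ] X} (h : IsPosInjective S) (hT : 0 ≤ T) :
    IsAccretivePair (liftL2 T S) (prim hT) where
  symm x y := by
    rw [L2.inner_def, L2.inner_def]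
    refine integral_congr_ae ?_
    filter_upwards [coeFn_liftL2 S x, coeFn_liftL2 S y] with t h1 h2
    rw [h1, h2, h.symm]
  inj x hx := by
    rw [Lp.eq_zero_iff_ae_eq_zero] at hx ⊢
    filter_upwards [hx, coeFn_liftL2 S x] with t h1 h2
    exact h.inj _ (h2.symm.trans h1)
  comm x := liftL2_prim hT S x
  nonneg x := by
    have h1 := inner_primitive_eq S h.symm (x.intervalIntegrable (right_mem_Icc.2 hT)) 0
    simp only [zero_add, inner_zero_right] at h1
    have h2 : inner ℝ (liftL2 T S x) (prim hT x) =
        ∫ t in (0 : ℝ)..T, inner ℝ (S (x t)) (∫ s in (0 : ℝ)..t, x s) := by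
      rw [L2.inner_def, intervalIntegral_eq_Ioo _ hT]
      refine integral_congr_ae ?_
      filter_upwards [coeFn_liftL2 S x, coeFn_prim hT x] with t h3 h4
      rw [h3, h4]
    have h3 := h.nonneg (∫ s in (0 : ℝ)..T, x s)
    rw [h2]
    linarith

/-- The velocity `-y'` of the solution of `S y' + y = 0`, `y(0) = S w`. -/
def IsPosInjective.velocity {S : X →L[ℝ] X} (h : IsPosInjective S) (hT : 0 ≤ T) :
    X →L[ℝ] L2Time T X :=
  -- With `p = -y'` the problem reads `S p = S w - K p`, so `p` is formally `S (S + K)⁻¹` applied to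
  -- the constant `w`.
  (h.isAccretivePair hT).fst.comp ((ofC hT).comp (constC T))

/-- The solution of `S y' + y = 0`, `y(0) = S w`. -/
def IsPosInjective.orbit {S : X →L[ℝ] X} (h : IsPosInjective S) (hT : 0 ≤ T) :
    X →L[ℝ] C(Icc (0 : ℝ) T, X) :=
  (constC T).comp S - (primC hT).comp (h.velocity hT)

variable {S : X →L[ℝ] X} (h : IsPosInjective S) (hT : 0 ≤ T)

lemma IsPosInjective.orbit_apply (w : X) (t : Icc (0 : ℝ) T) :
    h.orbit hT w t = S w - ∫ s in (0 : ℝ)..t, h.velocity hT w s := rfl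

/-- The evolution equation itself: splitting `w` into its `fst` and `snd` parts, `S w - K (fst w) =
S w - S (snd w) = S (fst w)`. -/
lemma IsPosInjective.ofC_orbit (w : X) :
    ofC hT (h.orbit hT w) = liftL2 T S (h.velocity hT w) := by
  have hp := h.isAccretivePair hT
  have e1 : ofC hT (h.orbit hT w) =
      ofC hT (constC T (S w)) - prim hT (hp.fst (ofC hT (constC T w))) := by
    rw [IsPosInjective.orbit, sub_apply, map_sub]
    rfl
  have e2 := hp.fst_add_snd (ofC hT (constC T w))
  rw [e1, ← liftL2_ofC_constC, ← hp.left_snd]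
  nth_rewrite 1 [← e2]
  rw [map_add, add_sub_cancel_right]
  rfl

/-- The energy identity. -/
lemma IsPosInjective.energy (w : X) (t : Icc (0 : ℝ) T) :
    ‖h.orbit hT w t‖ ^ 2 + 2 * ∫ s in (0 : ℝ)..t, inner ℝ (liftL2 T S (h.velocity hT w) s)
      (h.velocity hT w s) = ‖S w‖ ^ 2 := by
  set p := h.velocity hT w with hp
  have h1 := inner_primitive_eq (ContinuousLinearMap.id ℝ X) (fun _ _ => rfl)
    (p.intervalIntegrable t.2).neg (S w)
  simp only [ContinuousLinearMap.id_apply, Pi.neg_apply, intervalIntegral.integral_neg,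
    ← sub_eq_add_neg, real_inner_self_eq_norm_sq, inner_neg_left] at h1
  have h2 : ∫ s in (0 : ℝ)..t, inner ℝ (liftL2 T S p s) (p s) =
      ∫ s in (0 : ℝ)..t, inner ℝ (p s) (S w - ∫ r in (0 : ℝ)..s, p r) := by
    refine intervalIntegral_congr_ae_Ioo t.2 ?_
    rw [hp, ← h.ofC_orbit hT w]
    filter_upwards [coeFn_ofC hT (h.orbit hT w), ae_restrict_mem measurableSet_Ioo] with s h3 h4
    rw [h3, IccExtend_of_mem hT _ (Ioo_subset_Icc_self h4), h.orbit_apply, real_inner_comm]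
  rw [h2, h.orbit_apply, h1]
  ring

lemma IsPosInjective.norm_orbit_le (w : X) : ‖h.orbit hT w‖ ≤ 1 * ‖S w‖ := by
  rw [one_mul]
  refine (ContinuousMap.norm_le _ (norm_nonneg _)).2 fun t => ?_
  refine (pow_le_pow_iff_left₀ (norm_nonneg _) (norm_nonneg _) two_ne_zero).1 ?_
  linarith [h.energy hT w t, h.integral_inner_nonneg (h.velocity hT w) t.2]

/-- The dissipation in the energy identity controls every `R` whose square is dominated by the form
of `S`. Only the initial datum `S w` enters the bound, so it survives extension to all of `X`. -/
lemma IsPosInjective.norm_liftL2_velocity_le {V : Type} [NormedAddCommGroup V]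
    [InnerProductSpace ℝ V] {R : X →L[ℝ] V} {C : ℝ} (hC : 0 ≤ C)
    (hR : ∀ x, ‖R x‖ ^ 2 ≤ C * inner ℝ (S x) x) (w : X) :
    ‖liftL2 T R (h.velocity hT w)‖ ≤ √C * ‖S w‖ := by
  set p := h.velocity hT w with hp
  have h1 : ‖liftL2 T R p‖ ^ 2 ≤ C * inner ℝ (liftL2 T S p) p := by
    rw [← real_inner_self_eq_norm_sq, L2.inner_def, L2.inner_def, ← integral_const_mul]
    refine integral_mono_ae (L2.integrable_inner _ _) ((L2.integrable_inner _ _).const_mul _) ?_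
    filter_upwards [coeFn_liftL2 R p, coeFn_liftL2 S p] with t h3 h4
    rw [h3, h4, real_inner_self_eq_norm_sq]
    exact hR _
  have h2 := h.energy hT w ⟨T, right_mem_Icc.2 hT⟩
  rw [← hp, intervalIntegral_eq_Ioo _ hT] at h2
  have h3 : inner ℝ (liftL2 T S p) p ≤ ‖S w‖ ^ 2 := by
    rw [L2.inner_def]
    have h4 := h.integral_inner_nonneg p (right_mem_Icc.2 hT)
    rw [intervalIntegral_eq_Ioo _ hT] at h4
    linarith [sq_nonneg ‖h.orbit hT w ⟨T, right_mem_Icc.2 hT⟩‖]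
  refine (pow_le_pow_iff_left₀ (norm_nonneg _) (by positivity) two_ne_zero).1 ?_
  rw [mul_pow, Real.sq_sqrt hC]
  exact h1.trans (mul_le_mul_of_nonneg_left h3 hC)

end Parabolic

/-! ### The flow for arbitrary initial data -/

section Flow

lemma tendsto_liftL2 {X : Type} [NormedAddCommGroup X] [InnerProductSpace ℝ X] {T : ℝ} {ι : Type*}
    {l : Filter ι} {S : X →L[ℝ] X} {S' : ι → X →L[ℝ] X} (hl : Tendsto S' l (𝓝 S)) :
    Tendsto (fun i => liftL2 T (S' i)) l (𝓝 (liftL2 T S)) := by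
  refine (tendsto_iff_norm_sub_tendsto_zero (E := L2Time T X →L[ℝ] L2Time T X)).2 ?_
  exact squeeze_zero (fun i => norm_nonneg (liftL2 T (S' i) - liftL2 T S))
    (fun i => norm_liftL2_sub_le (S' i) S)
    (tendsto_iff_norm_sub_tendsto_zero.1 hl)

lemma exists_extension {E F G : Type*} [NormedAddCommGroup E] [NormedSpace ℝ E]
    [NormedAddCommGroup F] [NormedSpace ℝ F] [CompleteSpace F] [NormedAddCommGroup G]
    [NormedSpace ℝ G] (f : E →L[ℝ] F) (e : E →L[ℝ] G) (he : DenseRange e) {C : ℝ}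
    (hC : ∀ x, ‖f x‖ ≤ C * ‖e x‖) : ∃ U : G →L[ℝ] F, ∀ x, U (e x) = f x :=
  ⟨(f : E →ₗ[ℝ] F).extendOfNorm (e : E →ₗ[ℝ] G), fun x =>
    LinearMap.extendOfNorm_eq (f := (f : E →ₗ[ℝ] F)) (e := (e : E →ₗ[ℝ] G)) he ⟨C, hC⟩ x⟩

variable {X : Type} [NormedAddCommGroup X] [InnerProductSpace ℝ X] [CompleteSpace X] {T : ℝ}
  {S : X →L[ℝ] X} (h : IsPosInjective S) (hT : 0 ≤ T)

/-- The solution operator `y₀ ↦ y` of `S y' + y = 0`, `y(0) = y₀`. -/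
def IsPosInjective.flow : X →L[ℝ] C(Icc (0 : ℝ) T, X) :=
  (h.orbit hT : X →ₗ[ℝ] C(Icc (0 : ℝ) T, X)).extendOfNorm (S : X →ₗ[ℝ] X)

lemma IsPosInjective.flow_apply (w : X) : h.flow hT (S w) = h.orbit hT w :=
  LinearMap.extendOfNorm_eq (f := (h.orbit hT : X →ₗ[ℝ] C(Icc (0 : ℝ) T, X)))
    (e := (S : X →ₗ[ℝ] X)) h.denseRange ⟨1, h.norm_orbit_le hT⟩ w

lemma IsPosInjective.norm_flow_le (w : X) : ‖h.flow hT w‖ ≤ ‖w‖ :=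
  (LinearMap.norm_extendOfNorm_apply_le (f := (h.orbit hT : X →ₗ[ℝ] C(Icc (0 : ℝ) T, X)))
    (e := (S : X →ₗ[ℝ] X)) h.denseRange 1 (h.norm_orbit_le hT) w).trans_eq (one_mul _)

variable {ι : Type*} {l : Filter ι} {S' : ι → X →L[ℝ] X}

lemma IsPosInjective.tendsto_orbit (h' : ∀ i, IsPosInjective (S' i)) (hl : Tendsto S' l (𝓝 S))
    (w : X) : Tendsto (fun i => (h' i).orbit hT w) l (𝓝 (h.orbit hT w)) := by
  have h1 : Tendsto (fun i => S' i w) l (𝓝 (S w)) := tendsto_clm_apply hl tendsto_const_nhds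
  have h2 := (h.isAccretivePair hT).tendsto_fst (fun i => (h' i).isAccretivePair hT)
    (tendsto_liftL2 hl) (ofC hT (constC T w))
  exact (((constC T).continuous.tendsto _).comp h1).sub (((primC hT).continuous.tendsto _).comp h2)

lemma IsPosInjective.tendsto_flow (h' : ∀ i, IsPosInjective (S' i)) (hl : Tendsto S' l (𝓝 S))
    (y₀ : X) : Tendsto (fun i => (h' i).flow hT y₀) l (𝓝 (h.flow hT y₀)) := by
  rw [Metric.tendsto_nhds]
  intro η hη
  obtain ⟨w, hw⟩ := h.denseRange.exists_dist_lt y₀ (show (0 : ℝ) < η / 4 by positivity)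
  rw [dist_eq_norm] at hw
  have h1 : Tendsto (fun i => S' i w) l (𝓝 (S w)) := tendsto_clm_apply hl tendsto_const_nhds
  have h2 := h.tendsto_orbit hT h' hl w
  filter_upwards [Metric.tendsto_nhds.1 h1 (η / 4) (by positivity),
    Metric.tendsto_nhds.1 h2 (η / 4) (by positivity)] with i hi1 hi2
  rw [dist_eq_norm] at hi1 hi2 ⊢
  -- The datum `y₀` is replaced by `S w`, then by `S' i w`, whose flow is the explicit orbit. All
  -- flows being contractions, each of the four terms is below `η / 4`.
  have e : (h' i).flow hT y₀ - h.flow hT y₀ = (h' i).flow hT (y₀ - S w) -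
      (h' i).flow hT (S' i w - S w) + ((h' i).orbit hT w - h.orbit hT w) -
      h.flow hT (y₀ - S w) := by
    simp only [map_sub, IsPosInjective.flow_apply]
    abel
  rw [e]
  have b1 := (h' i).norm_flow_le hT (y₀ - S w)
  have b2 := (h' i).norm_flow_le hT (S' i w - S w)
  have b3 := h.norm_flow_le hT (y₀ - S w)
  have b4 := norm_sub_le ((h' i).flow hT (y₀ - S w) -
      (h' i).flow hT (S' i w - S w) + ((h' i).orbit hT w - h.orbit hT w)) (h.flow hT (y₀ - S w))
  have b5 := norm_add_le ((h' i).flow hT (y₀ - S w) - (h' i).flow hT (S' i w - S w))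
    ((h' i).orbit hT w - h.orbit hT w)
  have b6 := norm_sub_le ((h' i).flow hT (y₀ - S w)) ((h' i).flow hT (S' i w - S w))
  linarith

end Flow

/-! ### Weak solutions of the heat equation -/

section Heat

variable {c : ℝ → ℝ} {a₀ a₁ T : ℝ}

lemma IsElliptic.isPosInjective (hc : IsElliptic c a₀ a₁) : IsPosInjective hc.inv :=
  ⟨hc.inv_symm, hc.inv_nonneg, fun _ => hc.inv_injective⟩

lemma integrable_L2Time_apply (g : L2Time T (StrongDual ℝ H10)) (v : H10) :
    Integrable (fun t => g t v) (volume.restrict (Ioo (0 : ℝ) T)) :=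
  (integrable_L2Time g).apply_continuousLinearMap v

lemma liftL2_liftL2 {X Y Z : Type} [NormedAddCommGroup X] [NormedSpace ℝ X]
    [NormedAddCommGroup Y] [NormedSpace ℝ Y] [NormedAddCommGroup Z] [NormedSpace ℝ Z]
    (A : Y →L[ℝ] Z) (B : X →L[ℝ] Y) (x : L2Time T X) :
    liftL2 T A (liftL2 T B x) = liftL2 T (A.comp B) x := by
  ext1
  filter_upwards [coeFn_liftL2 A (liftL2 T B x), coeFn_liftL2 B x,
    coeFn_liftL2 (A.comp B) x] with t h1 h2 h3
  rw [h1, h2, h3]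
  rfl

/-- The heat equation `y_t - (c y_x)_x = F`, `y(0) = y₀` with homogeneous Dirichlet conditions,
tested with functions of `x` and integrated in time. -/
structure IsElliptic.IsMild (hc : IsElliptic c a₀ a₁) (hT : 0 ≤ T) (y₀ : L2) (F : L2Time T L2)
    (u : L2Time T H10) (y : C(Icc (0 : ℝ) T, L2)) : Prop where
  toL2_eq : liftL2 T toL2L u = ofC hT y
  eqn : ∀ (v : H10) (t : Icc (0 : ℝ) T), innerSL ℝ (toL2 v) (y t) = innerSL ℝ (toL2 v) y₀ +
    primC hT (liftL2 T (innerSL ℝ (toL2 v)) F - liftL2 T (hc.form.flip v) u) t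

lemma IsElliptic.IsMild.add {hc : IsElliptic c a₀ a₁} {hT : 0 ≤ T} {y₀ y₀' : L2}
    {F F' : L2Time T L2} {u u' : L2Time T H10} {y y' : C(Icc (0 : ℝ) T, L2)}
    (h : hc.IsMild hT y₀ F u y) (h' : hc.IsMild hT y₀' F' u' y') :
    hc.IsMild hT (y₀ + y₀') (F + F') (u + u') (y + y') := by
  refine ⟨by rw [map_add, map_add, h.toL2_eq, h'.toL2_eq], fun v t => ?_⟩
  rw [ContinuousMap.add_apply, map_add, h.eqn, h'.eqn]
  simp only [map_add, map_sub, ContinuousMap.add_apply, ContinuousMap.sub_apply]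
  ring

lemma IsElliptic.IsMild.sub {hc : IsElliptic c a₀ a₁} {hT : 0 ≤ T} {y₀ y₀' : L2}
    {F F' : L2Time T L2} {u u' : L2Time T H10} {y y' : C(Icc (0 : ℝ) T, L2)}
    (h : hc.IsMild hT y₀ F u y) (h' : hc.IsMild hT y₀' F' u' y') :
    hc.IsMild hT (y₀ - y₀') (F - F') (u - u') (y - y') := by
  refine ⟨by rw [map_sub, map_sub, h.toL2_eq, h'.toL2_eq], fun v t => ?_⟩
  rw [ContinuousMap.sub_apply, map_sub, h.eqn, h'.eqn]
  simp only [map_sub, ContinuousMap.sub_apply]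
  ring

lemma IsElliptic.form_flip_comp_solve (hc : IsElliptic c a₀ a₁) (v : H10) :
    (hc.form.flip v).comp hc.solve = innerSL ℝ (toL2 v) := by
  ext F
  change hc.form (hc.solve F) v = inner ℝ (toL2 v) F
  rw [hc.form_apply, hc.diffusionForm_solve, real_inner_comm]

lemma IsElliptic.form_flip_solve (hc : IsElliptic c a₀ a₁) (w : L2) :
    hc.form.flip (hc.solve w) = (innerSL ℝ w).comp toL2L := by
  ext u
  change hc.form u (hc.solve w) = inner ℝ w (toL2 u)
  rw [hc.form_apply, diffusionForm_comm, hc.diffusionForm_solve]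

lemma IsElliptic.innerSL_solve (hc : IsElliptic c a₀ a₁) (w : L2) :
    innerSL ℝ (toL2 (hc.solve w)) = (innerSL ℝ w).comp hc.inv := by
  ext x
  change inner ℝ (hc.inv w) x = inner ℝ w (hc.inv x)
  rw [hc.inv_symm]

lemma IsElliptic.isMild_orbit (hc : IsElliptic c a₀ a₁) (hT : 0 ≤ T) (w : L2) :
    hc.IsMild hT (hc.inv w) 0 (liftL2 T hc.solve (hc.isPosInjective.velocity hT w))
      (hc.isPosInjective.orbit hT w) := by
  refine ⟨?_, fun v t => ?_⟩
  · rw [liftL2_liftL2, hc.isPosInjective.ofC_orbit]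
    rfl
  · rw [map_zero, zero_sub, map_neg, liftL2_liftL2, hc.form_flip_comp_solve,
      ContinuousMap.neg_apply, primC_liftL2, hc.isPosInjective.orbit_apply, map_sub, primC_apply]
    ring

/-- Maximal regularity: `F` splits in `L²(0,T;L²)` into `y_t`, its `fst` part, and `-(c y_x)_x`, its
`snd` part. -/
lemma IsElliptic.isMild_force (hc : IsElliptic c a₀ a₁) (hT : 0 ≤ T) (F : L2Time T L2) :
    hc.IsMild hT 0 F (liftL2 T hc.solve ((hc.isPosInjective.isAccretivePair hT).snd F))
      (primC hT ((hc.isPosInjective.isAccretivePair hT).fst F)) := by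
  set hp := hc.isPosInjective.isAccretivePair hT
  refine ⟨?_, fun v t => ?_⟩
  · rw [liftL2_liftL2, ← prim_apply, ← hp.left_snd]
    rfl
  · rw [map_zero, zero_add, liftL2_liftL2, hc.form_flip_comp_solve, ← map_sub]
    have e : F - hp.snd F = hp.fst F := by
      rw [sub_eq_iff_eq_add, hp.fst_add_snd]
    rw [e, primC_liftL2]

/-- For data `S w` the orbit is explicit, and its `L²(0,T;H¹₀)` norm is bounded by a multiple of `‖S
w‖`. So `u` extends to all data, and both defining identities pass to the limit. -/
lemma IsElliptic.exists_isMild_flow (hc : IsElliptic c a₀ a₁) (hT : 0 ≤ T) (y₀ : L2) :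
    ∃ u, hc.IsMild hT y₀ 0 u (hc.isPosInjective.flow hT y₀) := by
  set hS := hc.isPosInjective
  have hb : ∀ w, ‖((liftL2 T hc.solve).comp (hS.velocity hT)) w‖ ≤ √(2 / a₀) * ‖hc.inv w‖ :=
    fun w => hS.norm_liftL2_velocity_le hT (div_nonneg zero_le_two hc.pos.le)
      hc.norm_solve_sq_le w
  obtain ⟨U, hU⟩ := exists_extension (E := L2) (F := L2Time T H10) (G := L2)
    ((liftL2 T hc.solve).comp (hS.velocity hT)) hc.inv
    hS.denseRange hb
  refine ⟨U y₀, ?_, fun v t => ?_⟩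
  · refine hS.denseRange.induction_on y₀ (isClosed_eq (by fun_prop) (by fun_prop)) fun w => ?_
    rw [hU, hS.flow_apply]
    exact (hc.isMild_orbit hT w).toL2_eq
  · have hev : Continuous fun z : C(Icc (0 : ℝ) T, L2) => z t := continuous_eval_const t
    have hev' : Continuous fun z : C(Icc (0 : ℝ) T, ℝ) => z t := continuous_eval_const t
    refine hS.denseRange.induction_on y₀ (isClosed_eq ?_ ?_) fun w => ?_
    · exact (innerSL ℝ (toL2 v)).continuous.comp (hev.comp (hS.flow hT).continuous)
    · exact (innerSL ℝ (toL2 v)).continuous.add (hev'.comp ((primC hT).continuous.comp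
        (continuous_const.sub ((liftL2 T (hc.form.flip v)).continuous.comp U.continuous))))
    · rw [hU, hS.flow_apply]
      exact (hc.isMild_orbit hT w).eqn v t

/-- The solution of the heat equation with initial datum `y₀` and right-hand side `F`. -/
def IsElliptic.heat (hc : IsElliptic c a₀ a₁) (hT : 0 ≤ T) (y₀ : L2) (F : L2Time T L2) :
    C(Icc (0 : ℝ) T, L2) :=
  hc.isPosInjective.flow hT y₀ + primC hT ((hc.isPosInjective.isAccretivePair hT).fst F)

lemma IsElliptic.exists_isMild_heat (hc : IsElliptic c a₀ a₁) (hT : 0 ≤ T) (y₀ : L2)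
    (F : L2Time T L2) : ∃ u, hc.IsMild hT y₀ F u (hc.heat hT y₀ F) := by
  obtain ⟨u, hu⟩ := hc.exists_isMild_flow hT y₀
  have := hu.add (hc.isMild_force hT F)
  rw [add_zero, zero_add] at this
  exact ⟨_, this⟩

/-- Testing with elliptic solutions eliminates `u` and leaves `S y(t) = -∫₀ᵗ y`, that is `(S + K) y
= 0`, and `S + K` is injective. -/
lemma IsElliptic.IsMild.eq_zero {hc : IsElliptic c a₀ a₁} (hT : 0 < T) {u : L2Time T H10}
    {y : C(Icc (0 : ℝ) T, L2)} (h : hc.IsMild hT.le 0 0 u y) : y = 0 := by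
  have h1 : ∀ t, (-primC hT.le (ofC hT.le y)) t = hc.inv (y t) := by
    intro t
    refine ext_inner_left ℝ fun w => ?_
    have h2 := h.eqn (hc.solve w) t
    rw [hc.innerSL_solve, hc.form_flip_solve, map_zero, map_zero, zero_add, zero_sub,
      ← liftL2_liftL2, h.toL2_eq, map_neg, ContinuousMap.neg_apply, primC_liftL2] at h2
    rw [ContinuousMap.neg_apply, inner_neg_right]
    exact h2.symm
  have h3 := liftL2_ofC hT.le hc.inv y _ h1
  rw [map_neg, ← prim_apply] at h3
  have h4 := (hc.isPosInjective.isAccretivePair hT.le).add_injective (x := ofC hT.le y) (by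
    rw [add_apply, h3, neg_add_cancel])
  exact ofC_injective hT (h4.trans (map_zero _).symm)

lemma IsElliptic.IsMild.eq_heat {hc : IsElliptic c a₀ a₁} (hT : 0 < T) {y₀ : L2}
    {F : L2Time T L2} {u : L2Time T H10} {y : C(Icc (0 : ℝ) T, L2)}
    (h : hc.IsMild hT.le y₀ F u y) : y = hc.heat hT.le y₀ F := by
  obtain ⟨u', h'⟩ := hc.exists_isMild_heat hT.le y₀ F
  have h1 := h.sub h'
  rw [sub_self, sub_self] at h1
  exact sub_eq_zero.1 (h1.eq_zero hT)

lemma IsElliptic.primC_sub_apply (hc : IsElliptic c a₀ a₁) (hT : 0 ≤ T) (F : L2Time T L2)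
    (u : L2Time T H10) (v : H10) (t : Icc (0 : ℝ) T) {g : ℝ → ℝ}
    (hg : ∀ᵐ s ∂volume.restrict (Ioo (0 : ℝ) T),
      g s + diffusionForm c (u s) v = inner ℝ (F s) (toL2 v)) :
    primC hT (liftL2 T (innerSL ℝ (toL2 v)) F - liftL2 T (hc.form.flip v) u) t =
      ∫ s in (0 : ℝ)..t, g s := by
  rw [primC_apply]
  refine intervalIntegral_congr_ae_Ioo t.2 ?_
  filter_upwards [hg, Lp.coeFn_sub (liftL2 T (innerSL ℝ (toL2 v)) F) (liftL2 T (hc.form.flip v) u),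
    coeFn_liftL2 (innerSL ℝ (toL2 v)) F, coeFn_liftL2 (hc.form.flip v) u] with s h1 h2 h3 h4
  rw [h2, Pi.sub_apply, h3, h4, ContinuousLinearMap.flip_apply, hc.form_apply,
    innerSL_apply_apply, real_inner_comm, ← h1]
  ring

lemma IsTest.integral_deriv_eq_zero (hT : 0 ≤ T) {φ : ℝ → ℝ} (hφ : IsTest 0 T φ) :
    ∫ t in Ioo (0 : ℝ) T, deriv φ t = 0 := by
  rw [← intervalIntegral_eq_Ioo _ hT, intervalIntegral.integral_deriv_eq_sub
    (fun y _ => hφ.differentiable y) (hφ.continuous_deriv.intervalIntegrable _ _),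
    hφ.eq_zero right_notMem_Ioo, hφ.eq_zero left_notMem_Ioo, sub_zero]

variable {ω : Set ℝ} {B : L2 →L[ℝ] L2}

lemma IsElliptic.IsMild.isHeatSolution {hc : IsElliptic c a₀ a₁} {hT : 0 ≤ T} {y₀ : L2}
    {f : L2Time T L2} {u : L2Time T H10} {y : C(Icc (0 : ℝ) T, L2)}
    (hB : ∀ (f : L2) (v : H10), controlPairing ω f v = inner ℝ (B f) (toL2 v))
    (h : hc.IsMild hT y₀ (liftL2 T B f) u y) : IsHeatSolution hT ω c y₀ f y := by
  let J : L2 →L[ℝ] StrongDual ℝ H10 :=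
    (innerSL ℝ : L2 →L[ℝ] L2 →L[ℝ] ℝ).bilinearComp (ContinuousLinearMap.id ℝ L2) toL2L
  have hJ : ∀ F v, J F v = inner ℝ F (toL2 v) := fun _ _ => rfl
  -- The time derivative is read off from the equation in `H⁻¹`.
  set g : L2Time T (StrongDual ℝ H10) := liftL2 T J (liftL2 T B f) -
    liftL2 (X := H10) (Y := StrongDual ℝ H10) T hc.form u with hg
  have hgv : ∀ᵐ t ∂volume.restrict (Ioo (0 : ℝ) T), ∀ v,
      g t v + diffusionForm c (u t) v = inner ℝ (liftL2 T B f t) (toL2 v) := by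
    filter_upwards [Lp.coeFn_sub (liftL2 T J (liftL2 T B f))
        (liftL2 (X := H10) (Y := StrongDual ℝ H10) T hc.form u),
      coeFn_liftL2 (X := L2) (Y := StrongDual ℝ H10) J (liftL2 T B f), coeFn_liftL2 (X := H10) (Y := StrongDual ℝ H10) hc.form u] with t h1 h2 h3 v
    rw [hg, h1, Pi.sub_apply, h2, h3, sub_apply, hJ, hc.form_apply, sub_add_cancel]
  have hu : ∀ᵐ t ∂volume.restrict (Ioo (0 : ℝ) T), toL2 (u t) = IccExtend hT y t := by
    have h1 := coeFn_liftL2 toL2L u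
    rw [h.toL2_eq] at h1
    filter_upwards [h1, coeFn_ofC hT y] with t h2 h3
    rw [← h3, h2, toL2L_apply]
  refine ⟨?_, u, g, hu, fun φ hφ v => ?_, fun v => ?_⟩
  · rw [← sub_eq_zero]
    refine eq_zero_of_forall_inner_toL2 fun v => ?_
    have h1 := h.eqn v ⟨0, left_mem_Icc.2 hT⟩
    rw [primC_apply, intervalIntegral.integral_same, add_zero] at h1
    rw [inner_sub_left, real_inner_comm, real_inner_comm (toL2 v) y₀, sub_eq_zero]
    exact h1
  · have hgi : Integrable (fun t => g t v) (volume.restrict (Ioo (0 : ℝ) T)) :=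
      integrable_L2Time_apply g v
    rw [← integral_deriv_mul_primitive hT hφ hgi]
    have h1 : ∀ᵐ t ∂volume.restrict (Ioo (0 : ℝ) T),
        deriv φ t * inner ℝ (toL2 (u t)) (toL2 v) =
          deriv φ t * inner ℝ y₀ (toL2 v) + deriv φ t * ∫ s in (0 : ℝ)..t, g s v := by
      filter_upwards [hu, ae_restrict_mem measurableSet_Ioo] with t h2 h3
      have h4 := h.eqn v ⟨t, Ioo_subset_Icc_self h3⟩
      rw [hc.primC_sub_apply hT _ _ v _ (hgv.mono fun s hs => hs v)] at h4
      rw [h2, IccExtend_of_mem hT _ (Ioo_subset_Icc_self h3), ← mul_add, real_inner_comm,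
        real_inner_comm (toL2 v) y₀]
      exact congrArg _ h4
    have hint : ∀ {k : ℝ → ℝ}, ContinuousOn k (Icc 0 T) →
        Integrable (fun t => deriv φ t * k t) (volume.restrict (Ioo (0 : ℝ) T)) := fun hk =>
      (hφ.continuous_deriv.continuousOn.mul hk).integrableOn_Icc.mono_set Ioo_subset_Icc_self
    have hp : ContinuousOn (fun t => ∫ s in (0 : ℝ)..t, g s v) (Icc 0 T) := by
      have := intervalIntegral.continuousOn_primitive_interval'
        (intervalIntegrable_of_integrable_Ioo hT hgi) left_mem_uIcc
      rwa [uIcc_of_le hT] at this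
    rw [integral_congr_ae h1, integral_add (hint continuousOn_const) (hint hp), integral_mul_const,
      hφ.integral_deriv_eq_zero hT, zero_mul, zero_add]
  · filter_upwards [hgv, coeFn_liftL2 B f] with t h1 h2
    rw [h1, h2, hB]

/-- For fixed `v`, the function `t ↦ ⟨y(t), v⟩` is continuous with an integrable distributional
derivative, so it is recovered from its initial value by integration. -/
lemma IsElliptic.exists_isMild (hc : IsElliptic c a₀ a₁) (hT : 0 < T) {y₀ : L2}
    {f : L2Time T L2} {y : C(Icc (0 : ℝ) T, L2)}
    (hB : ∀ (f : L2) (v : H10), controlPairing ω f v = inner ℝ (B f) (toL2 v))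
    (h : IsHeatSolution hT.le ω c y₀ f y) : ∃ u, hc.IsMild hT.le y₀ (liftL2 T B f) u y := by
  obtain ⟨h0, u, g, hu, hg, heq⟩ := h
  refine ⟨u, ?_, fun v t => ?_⟩
  · ext1
    filter_upwards [hu, coeFn_liftL2 toL2L u, coeFn_ofC hT.le y] with t h1 h2 h3
    rw [h2, h3, toL2L_apply, h1]
  · have hgi : Integrable (fun t => g t v) (volume.restrict (Ioo (0 : ℝ) T)) :=
      integrable_L2Time_apply g v
    rw [hc.primC_sub_apply hT.le _ _ v t (g := fun s => g s v) (by
      filter_upwards [heq v, coeFn_liftL2 B f] with s h1 h2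
      rw [h1, h2, hB])]
    have hcont : ContinuousOn (fun t => inner ℝ (IccExtend hT.le y t) (toL2 v)) (Icc 0 T) :=
      ((Continuous.Icc_extend' y.continuous).inner continuous_const).continuousOn
    have h1 := eq_add_integral_of_weak_deriv hT hcont hgi (fun φ hφ => by
      rw [← hg φ hφ v]
      refine integral_congr_ae ?_
      filter_upwards [hu] with s hs
      rw [hs]) t t.2
    rw [IccExtend_val, IccExtend_of_mem hT.le _ (left_mem_Icc.2 hT.le), h0] at h1
    rw [innerSL_apply_apply, innerSL_apply_apply, real_inner_comm, h1, real_inner_comm]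

/-- Existence and uniqueness for the heat equation. -/
lemma IsElliptic.isHeatSolution_iff (hc : IsElliptic c a₀ a₁) (hT : 0 < T) (y₀ : L2)
    (hB : ∀ (f : L2) (v : H10), controlPairing ω f v = inner ℝ (B f) (toL2 v))
    (f : L2Time T L2) (y : C(Icc (0 : ℝ) T, L2)) :
    IsHeatSolution hT.le ω c y₀ f y ↔ y = hc.heat hT.le y₀ (liftL2 T B f) := by
  constructor
  · intro h
    obtain ⟨u, hu⟩ := hc.exists_isMild hT hB h
    exact hu.eq_heat hT
  · rintro rfl
    obtain ⟨u, hu⟩ := hc.exists_isMild_heat hT.le y₀ (liftL2 T B f)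
    exact hu.isHeatSolution hB

end Heat

/-! ### The optimal control problems -/

section OptimalControl

open ContinuousLinearMap (adjoint)

variable {c : ℝ → ℝ} {a₀ a₁ T : ℝ} {ω : Set ℝ} {B : L2 →L[ℝ] L2}

section Stationary

lemma IsElliptic.isStatSolution_iff (hc : IsElliptic c a₀ a₁)
    (hB : ∀ (f : L2) (v : H10), controlPairing ω f v = inner ℝ (B f) (toL2 v)) (f : L2) (y : H10) :
    IsStatSolution ω c f y ↔ y = hc.solve (B f) := by
  simp only [IsStatSolution, hB]
  constructor
  · exact hc.eq_solve
  · rintro rfl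
    exact hc.diffusionForm_solve _

/-- Eliminating the state leaves the quadratic problem with `L = hc.inv.comp B` and `b = -yd`. -/
lemma IsElliptic.isStatOptimal_iff (hc : IsElliptic c a₀ a₁)
    (hB : ∀ (f : L2) (v : H10), controlPairing ω f v = inner ℝ (B f) (toL2 v)) (yd f : L2)
    (y : H10) : IsStatOptimal ω c yd y f ↔ y = hc.solve (B f) ∧
      f + adjoint (hc.inv.comp B) (hc.inv.comp B f + -yd) = 0 := by
  rw [← isMin_iff_eulerLagrange, IsStatOptimal, hc.isStatSolution_iff hB]
  refine and_congr_right ?_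
  rintro rfl
  have hcost : ∀ g, statCost yd g (hc.solve (B g)) =
      1 / 2 * (‖g‖ ^ 2 + ‖hc.inv.comp B g + -yd‖ ^ 2) := fun g => by
    rw [statCost, ← sub_eq_add_neg]
    rfl
  simp only [hc.isStatSolution_iff hB, hcost]
  constructor
  · intro h g
    have := h _ g rfl
    rw [hcost] at this
    linarith
  · rintro h z g rfl
    rw [hcost]
    linarith [h g]

end Stationary

section Evolution

lemma integral_norm_sq_eq {X : Type} [NormedAddCommGroup X] [InnerProductSpace ℝ X]
    (x : L2Time T X) : ∫ t in Ioo (0 : ℝ) T, ‖x t‖ ^ 2 = ‖x‖ ^ 2 := by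
  rw [← real_inner_self_eq_norm_sq, L2.inner_def]
  simp_rw [real_inner_self_eq_norm_sq]

lemma integrable_norm_sq {X : Type} [NormedAddCommGroup X] [InnerProductSpace ℝ X]
    (x : L2Time T X) : Integrable (fun t => ‖x t‖ ^ 2) (volume.restrict (Ioo (0 : ℝ) T)) :=
  (Lp.memLp x).integrable_norm_pow (by norm_num)

lemma heatCost_eq (hT : 0 ≤ T) (yd : L2) (f : L2Time T L2) (y : C(Icc (0 : ℝ) T, L2)) :
    heatCost hT yd f y = 1 / 2 * (‖f‖ ^ 2 + ‖ofC hT (y - constC T yd)‖ ^ 2) := by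
  rw [heatCost, ← integral_norm_sq_eq, ← integral_norm_sq_eq,
    ← integral_add (integrable_norm_sq f) (integrable_norm_sq _)]
  congr 1
  refine integral_congr_ae ?_
  filter_upwards [coeFn_ofC hT (y - constC T yd)] with t ht
  rw [ht]
  rfl

/-- The part of the control-to-state map that is linear in the control. -/
def IsElliptic.controlToState (hc : IsElliptic c a₀ a₁) (hT : 0 ≤ T) (B : L2 →L[ℝ] L2) :
    L2Time T L2 →L[ℝ] L2Time T L2 :=
  ((prim hT).comp (hc.isPosInjective.isAccretivePair hT).fst).comp (liftL2 T B)

lemma IsElliptic.ofC_heat (hc : IsElliptic c a₀ a₁) (hT : 0 ≤ T) (y₀ yd : L2)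
    (f : L2Time T L2) : ofC hT (hc.heat hT y₀ (liftL2 T B f) - constC T yd) =
      hc.controlToState hT B f + ofC hT (hc.isPosInjective.flow hT y₀ - constC T yd) := by
  rw [IsElliptic.heat, add_sub_right_comm, map_add, add_comm]
  rfl

/-- The state is affine in the control: the linear part is `hc.controlToState`, and the free
evolution minus the target plays the role of `b`. -/
lemma IsElliptic.isHeatOptimal_iff (hc : IsElliptic c a₀ a₁) (hT : 0 < T)
    (hB : ∀ (f : L2) (v : H10), controlPairing ω f v = inner ℝ (B f) (toL2 v)) (y₀ yd : L2)
    (y : C(Icc (0 : ℝ) T, L2)) (f : L2Time T L2) :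
    IsHeatOptimal hT.le ω c y₀ yd y f ↔ y = hc.heat hT.le y₀ (liftL2 T B f) ∧
      f + adjoint (hc.controlToState hT.le B) (hc.controlToState hT.le B f +
        ofC hT.le (hc.isPosInjective.flow hT.le y₀ - constC T yd)) = 0 := by
  rw [← isMin_iff_eulerLagrange, IsHeatOptimal, hc.isHeatSolution_iff hT y₀ hB]
  refine and_congr_right ?_
  rintro rfl
  have hcost : ∀ g, heatCost hT.le yd g (hc.heat hT.le y₀ (liftL2 T B g)) =
      1 / 2 * (‖g‖ ^ 2 + ‖hc.controlToState hT.le B g +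
        ofC hT.le (hc.isPosInjective.flow hT.le y₀ - constC T yd)‖ ^ 2) := fun g => by
    rw [heatCost_eq, hc.ofC_heat]
  simp only [hc.isHeatSolution_iff hT y₀ hB, hcost]
  constructor
  · intro h g
    have := h _ g rfl
    rw [hcost] at this
    linarith
  · rintro h z g rfl
    rw [hcost]
    linarith [h g]

end Evolution

section ExistenceUniqueness

lemma existsUnique_prod {X Y : Type*} {P : X × Y → Prop} {Q : Y → Prop} {s : Y → X}
    (hP : ∀ p, P p ↔ p.1 = s p.2 ∧ Q p.2) (hex : ∃ f, Q f) (huniq : ∀ f g, Q f → Q g → f = g) :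
    ∃! p, P p := by
  obtain ⟨f, hf⟩ := hex
  refine ⟨(s f, f), (hP _).2 ⟨rfl, hf⟩, fun p hp => ?_⟩
  obtain ⟨h1, h2⟩ := (hP p).1 hp
  have h3 := huniq _ _ h2 hf
  exact Prod.ext (by rw [h1, h3]) h3

lemma IsElliptic.existsUnique_isStatOptimal (hc : IsElliptic c a₀ a₁) (hω : MeasurableSet ω)
    (yd : L2) : ∃! p : H10 × L2, IsStatOptimal ω c yd p.1 p.2 := by
  obtain ⟨B, hB⟩ := exists_control hω
  exact existsUnique_prod (s := fun f => hc.solve (B f)) (fun p => hc.isStatOptimal_iff hB yd p.2 p.1)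
    (Q := fun f => f + adjoint (hc.inv.comp B) ((hc.inv.comp B) f + -yd) = 0) (exists_eulerLagrange _ _)
    fun _ _ => eulerLagrange_unique

lemma IsElliptic.existsUnique_isHeatOptimal (hc : IsElliptic c a₀ a₁) (hω : MeasurableSet ω)
    (hT : 0 < T) (y₀ yd : L2) : ∃! p : C(Icc (0 : ℝ) T, L2) × L2Time T L2,
      IsHeatOptimal hT.le ω c y₀ yd p.1 p.2 := by
  obtain ⟨B, hB⟩ := exists_control hω
  exact existsUnique_prod (s := fun f => hc.heat hT.le y₀ (liftL2 T B f))
    (fun p => hc.isHeatOptimal_iff hT hB y₀ yd p.1 p.2)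
    (Q := fun f => f + adjoint (hc.controlToState hT.le B) (hc.controlToState hT.le B f +
      ofC hT.le (hc.isPosInjective.flow hT.le y₀ - constC T yd)) = 0) (exists_eulerLagrange _ _)
    fun _ _ => eulerLagrange_unique

end ExistenceUniqueness

section Convergence

variable {ι : Type*} {l : Filter ι} {c' : ι → ℝ → ℝ}

lemma tendsto_isStatOptimal (hc : IsElliptic c a₀ a₁) (hc' : ∀ i, IsElliptic (c' i) a₀ a₁)
    (hl : Tendsto (fun i => (hc' i).inv) l (𝓝 hc.inv)) (hω : MeasurableSet ω) {yd : L2}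
    {y' : ι → H10} {f' : ι → L2} {y : H10} {f : L2}
    (h' : ∀ i, IsStatOptimal ω (c' i) yd (y' i) (f' i)) (h : IsStatOptimal ω c yd y f) :
    Tendsto f' l (𝓝 f) ∧ Tendsto (fun i => toL2 (y' i)) l (𝓝 (toL2 y)) := by
  obtain ⟨B, hB⟩ := exists_control hω
  have h1 := (hc.isStatOptimal_iff hB yd f y).1 h
  have h1' := fun i => ((hc' i).isStatOptimal_iff hB yd (f' i) (y' i)).1 (h' i)
  have hL : Tendsto (fun i => (hc' i).inv.comp B) l (𝓝 (hc.inv.comp B)) :=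
    ((ContinuousLinearMap.precomp L2 B).continuous.tendsto _).comp hl
  have hf : Tendsto f' l (𝓝 f) :=
    tendsto_of_eulerLagrange h1.2 (fun i => (h1' i).2) hL tendsto_const_nhds
  refine ⟨hf, ?_⟩
  have e : ∀ i, toL2 (y' i) = (hc' i).inv.comp B (f' i) := fun i => by
    rw [(h1' i).1]
    rfl
  have e' : toL2 y = hc.inv.comp B f := by
    rw [h1.1]
    rfl
  simp_rw [e, e']
  exact tendsto_clm_apply hL hf

lemma tendsto_isHeatOptimal (hc : IsElliptic c a₀ a₁) (hc' : ∀ i, IsElliptic (c' i) a₀ a₁)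
    (hl : Tendsto (fun i => (hc' i).inv) l (𝓝 hc.inv)) (hω : MeasurableSet ω) (hT : 0 < T)
    {y₀ yd : L2} {y' : ι → C(Icc (0 : ℝ) T, L2)} {f' : ι → L2Time T L2}
    {y : C(Icc (0 : ℝ) T, L2)} {f : L2Time T L2}
    (h' : ∀ i, IsHeatOptimal hT.le ω (c' i) y₀ yd (y' i) (f' i))
    (h : IsHeatOptimal hT.le ω c y₀ yd y f) :
    Tendsto f' l (𝓝 f) ∧ Tendsto y' l (𝓝 y) := by
  obtain ⟨B, hB⟩ := exists_control hω
  have h1 := (hc.isHeatOptimal_iff hT hB y₀ yd y f).1 h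
  have h1' := fun i => ((hc' i).isHeatOptimal_iff hT hB y₀ yd (y' i) (f' i)).1 (h' i)
  have hS := hc.isPosInjective
  have hS' := fun i => (hc' i).isPosInjective
  have hp := hS.isAccretivePair hT.le
  have hp' := fun i => (hS' i).isAccretivePair hT.le
  have hlift := tendsto_liftL2 (T := T) hl
  have hL0 : Tendsto (fun i => (prim hT.le).comp (hp' i).fst) l (𝓝 ((prim hT.le).comp hp.fst)) := by
    refine (tendsto_iff_norm_sub_tendsto_zero (E := L2Time T L2 →L[ℝ] L2Time T L2)).2 ?_
    exact squeeze_zero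
      (fun i => norm_nonneg ((prim hT.le).comp (hp' i).fst - (prim hT.le).comp hp.fst))
      (fun i => (hp' i).norm_right_comp_fst_sub_le hp)
      ((tendsto_iff_norm_sub_tendsto_zero (E := L2Time T L2 →L[ℝ] L2Time T L2)).1 hlift)
  have hL : Tendsto (fun i => (hc' i).controlToState hT.le B) l
      (𝓝 (hc.controlToState hT.le B)) :=
    ((ContinuousLinearMap.precomp (L2Time T L2) (liftL2 T B)).continuous.tendsto _).comp hL0
  have hflow := hS.tendsto_flow hT.le hS' hl y₀
  have hf : Tendsto f' l (𝓝 f) :=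
    tendsto_of_eulerLagrange h1.2 (fun i => (h1' i).2) hL
      (((ofC hT.le).continuous.tendsto _).comp (hflow.sub_const _))
  refine ⟨hf, ?_⟩
  have hBf : Tendsto (fun i => liftL2 T B (f' i) - liftL2 T B f) l (𝓝 0) := by
    have := ((liftL2 T B).continuous.tendsto f).comp hf
    simpa using! this.sub_const (liftL2 T B f)
  -- Convergence of the states in `C([0,T];L²)` is stronger than what the cost sees. It follows from
  -- strong convergence of the time derivatives `fst (B f)` in `L²(0,T;L²)`: contractivity absorbs
  -- the change of control.
  have hfst : Tendsto (fun i => (hp' i).fst (liftL2 T B (f' i))) l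
      (𝓝 (hp.fst (liftL2 T B f))) := by
    have t1 := hp.tendsto_fst hp' hlift (liftL2 T B f)
    have t2 : Tendsto (fun i => (hp' i).fst (liftL2 T B (f' i) - liftL2 T B f)) l (𝓝 0) :=
      squeeze_zero_norm (fun i => (hp' i).norm_fst_le _) (tendsto_zero_iff_norm_tendsto_zero.1 hBf)
    have t3 := t2.add t1
    simpa using t3
  have e : y' = fun i => (hc' i).heat hT.le y₀ (liftL2 T B (f' i)) := funext fun i => (h1' i).1
  rw [e, h1.1]
  exact hflow.add (((primC hT.le).continuous.tendsto _).comp hfst)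

end Convergence

end OptimalControl

end HeatHomogenization
end

/-! ### The homogenization theorem -/

open HeatHomogenization
theorem propositionA1
    (a : ℝ → ℝ) (a₀ a₁ : ℝ) (ha_meas : AEStronglyMeasurable a volume)
    (ha_per : Function.Periodic a 1) (ha₀ : 0 < a₀)
    (ha_bdd : ∀ᵐ x ∂(volume : Measure ℝ), a₀ ≤ a x ∧ a x ≤ a₁)
    (ω : Set ℝ) (hω_open : IsOpen ω) (hω_ne : ω.Nonempty) (hω_sub : ω ⊆ Ioo (0 : ℝ) 1)
    (T : ℝ) (hT : 0 < T) (y₀ yd : L2) :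
    -- existence and uniqueness of all the optimal pairs
    ((∀ ε : ℝ, 0 < ε →
        ∃! p : C(Icc (0 : ℝ) T, L2) × L2Time T L2,
          IsHeatOptimal hT.le ω (oscCoeff a ε) y₀ yd p.1 p.2) ∧
      (∃! p : C(Icc (0 : ℝ) T, L2) × L2Time T L2,
          IsHeatOptimal hT.le ω (homCoeff a) y₀ yd p.1 p.2) ∧
      (∀ ε : ℝ, 0 < ε →
        ∃! p : H10 × L2, IsStatOptimal ω (oscCoeff a ε) yd p.1 p.2) ∧
      (∃! p : H10 × L2, IsStatOptimal ω (homCoeff a) yd p.1 p.2)) ∧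
    -- convergence of the evolutionary optimal pairs
    (∀ (yε : ℝ → C(Icc (0 : ℝ) T, L2)) (fε : ℝ → L2Time T L2)
        (y : C(Icc (0 : ℝ) T, L2)) (f : L2Time T L2),
      (∀ ε : ℝ, 0 < ε → IsHeatOptimal hT.le ω (oscCoeff a ε) y₀ yd (yε ε) (fε ε)) →
      IsHeatOptimal hT.le ω (homCoeff a) y₀ yd y f →
      Tendsto fε (𝓝[>] 0) (𝓝 f) ∧ Tendsto yε (𝓝[>] 0) (𝓝 y)) ∧
    -- convergence of the stationary optimal pairs
    (∀ (yε : ℝ → H10) (fε : ℝ → L2) (y : H10) (f : L2),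
      (∀ ε : ℝ, 0 < ε → IsStatOptimal ω (oscCoeff a ε) yd (yε ε) (fε ε)) →
      IsStatOptimal ω (homCoeff a) yd y f →
      Tendsto fε (𝓝[>] 0) (𝓝 f) ∧
      Tendsto (fun ε => toL2 (yε ε)) (𝓝[>] 0) (𝓝 (toL2 y))) := by
  have hh := isElliptic_homCoeff ha_meas ha₀ ha_bdd
  have ho : ∀ i : Ioi (0 : ℝ), IsElliptic (oscCoeff a i) a₀ a₁ := fun i =>
    isElliptic_oscCoeff ha_meas ha₀ ha_bdd i.2
  have hω := hω_open.measurableSet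
  -- Ellipticity of `a_ε` is available only for `ε > 0`, so limits are taken along the subtype of
  -- positive reals and transferred back to `𝓝[>] 0`.
  have hrange : range ((↑) : Ioi (0 : ℝ) → ℝ) ∈ 𝓝[>] (0 : ℝ) := by
    rw [Subtype.range_coe]
    exact self_mem_nhdsWithin
  have hl : Tendsto (fun i => (ho i).inv) (comap (↑) (𝓝[>] (0 : ℝ))) (𝓝 hh.inv) := by
    obtain ⟨C, hC⟩ := exists_norm_inv_sub_inv_le ha_meas ha_per ha₀ ha_bdd
    rw [tendsto_iff_norm_sub_tendsto_zero]
    refine squeeze_zero (fun _ => norm_nonneg _) (fun i => hC i i.2) ?_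
    have h0 : Tendsto (fun ε : ℝ => C * ε) (𝓝[>] 0) (𝓝 0) := by
      have : Tendsto (fun ε : ℝ => C * ε) (𝓝 0) (𝓝 (C * 0)) :=
        (continuous_const.mul continuous_id).tendsto 0
      rw [mul_zero] at this
      exact this.mono_left nhdsWithin_le_nhds
    exact h0.comp tendsto_comap
  refine ⟨⟨fun ε hε => (ho ⟨ε, hε⟩).existsUnique_isHeatOptimal hω hT y₀ yd,
    hh.existsUnique_isHeatOptimal hω hT y₀ yd,
    fun ε hε => (ho ⟨ε, hε⟩).existsUnique_isStatOptimal hω yd,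
    hh.existsUnique_isStatOptimal hω yd⟩, fun yε fε y f h' h => ?_, fun yε fε y f h' h => ?_⟩
  · have := tendsto_isHeatOptimal hh ho hl hω hT (fun i => h' i i.2) h
    exact ⟨(tendsto_comap'_iff hrange).1 this.1, (tendsto_comap'_iff hrange).1 this.2⟩
  · have := tendsto_isStatOptimal hh ho hl hω (fun i => h' i i.2) h
    exact ⟨(tendsto_comap'_iff hrange).1 this.1, (tendsto_comap'_iff hrange).1 this.2⟩
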